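/- Let $k\ge 1$ and consider $6k$ qubits labelled $B_i,L_i,R_i$ ($1\le i\le 2k$). Let $\mathcal G$ be the group generated by the operators $X_{B_i}X_{R_i}$, $Z_{B_i}Z_{L_i}$ ($1\le i\le 2k$), $X_{L_i}X_{L_{i+1}}$, $Z_{R_i}Z_{R_{i+1}}$ ($1\le i\le 2k-1$) (the gauge group of a $[[6k,2k,2]]$ subsystem code), and let $\bar X_i=X_{B_i}X_{L_i}$, $\bar Z_i=Z_{B_i}Z_{R_i}$ be its bare logical operators. Let $G'$ be a finite set of operators, each of X-type (a product of $X_q$'s) or of Z-type (a product of $Z_q$'s), that generates $\mathcal G$. Put $H_p=-\sum_{g\in G'}g$, with eigen-decomposition $H_p=\sum_a\lambda_a\Pi_a$ (distinct $\lambda_a$), and let $\Pi_0$ be the projector to its ground space. Then there are numbers $\alpha^x_{ij},\alpha^z_{ij}>0$, depending only on $H_p$, with $$\Pi_0X_{L_i}X_{L_j}\Pi_0=\alpha^x_{ij}\Pi_0,\qquad \Pi_0Z_{R_i}Z_{R_j}\Pi_0=\alpha^z_{ij}\Pi_0,$$ such that the following holds. Let $T\ge 0$, let $a_i,b_i,c_{ij},d_{ij}$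 be real continuous functions on $[0,T]$, and put $$\bar H_s(t)=\sum_i a_i\bar X_i+\sum_i b_i\bar Z_i+\sum_{i,j}c_{ij}\bar X_i\bar X_j+\sum_{i,j}d_{ij}\bar Z_i\bar Z_j,$$ $$\hat H_s(t)=\sum_i a_iX_{L_i}X_{B_i}+\sum_i b_iZ_{B_i}Z_{R_i}+\sum_{i,j}\frac{c_{ij}}{\alpha^x_{ij}}X_{B_i}X_{B_j}+\sum_{i,j}\frac{d_{ij}}{\alpha^z_{ij}}Z_{B_i}Z_{B_j}.$$ Let the bath be a complex Hilbert space with a bounded self-adjoint $H_B$, and let $H_{SB}=\sum_{q}\sum_{\sigma\in\{X,Y,Z\}}\sigma_q\otimes B_{q,\sigma}$ be one-local, with bounded self-adjoint $B_{q,\sigma}$. For $E_p>0$ let $U$ and $\bar U$ be the evolutions on $[0,T]$ generated by $\hat H_s(t)+E_pH_p+H_B+H_{SB}$ and by the decoupled $\bar H_s(t)+H_B+E_pH_p$, respectively. Put $$H_0(t)=\sum_a\Pi_a\hat H_s(t)\Pi_a+H_B,\quad V(t)=\sum_{a\ne a'}\Pi_a\hat H_s(t)\Pi_{a'}+H_{SB},\quad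 W(t)=\Pi_0V(t)\Pi_0,$$ $$K(t)=\int_0^te^{iE_pH_p\tau}\,(V(\tau)-W(\tau))\,e^{-iE_pH_p\tau}\,\Pi_0\,d\tau .$$ All norms are operator norms, and all suprema are over $t\in[0,T]$. 1. $\Pi_0H_{SB}\Pi_0=0$ and $\Pi_0\hat H_s(t)\Pi_0=\Pi_0\bar H_s(t)\Pi_0$. 2. For every $E_p>0$, $$\|U(T)\Pi_0-\bar U(T)\Pi_0\|\le\|K(T)\|+T\,\sup_t\big(\|V(t)\|+\|W(t)\|\big)\,\sup_t\|K(t)\|+T\sup_t\|[K(t),H_0(t)]\|.$$ 3. If $a_i,b_i,c_{ij},d_{ij}$ are continuously differentiable on $[0,T]$, then for every $E_p>0$ and $t\in[0,T]$ $$\|K(t)\|\le\frac{\kappa}{E_p},\qquad \kappa=\Big(2\sup_t\|V(t)-W(t)\|+T\sup_t\big\|\tfrac{d}{dt}(V(t)-W(t))\big\|\Big)\sum_{a\ne a'}\frac1{|\lambda_a-\lambda_{a'}|},$$ and therefore $$\|U(T)\Pi_0-\bar U(T)\Pi_0\|\le\frac{\kappa}{E_p}\Big(1+T\sup_t\big(\|V(t)\|+\|W(t)\|\big)+2T\sup_t\|H_0(t)\|\Big),$$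 where nothing but the explicit factor $1/E_p$ depends on $E_p$. (If $\hat H_s$ does not depend on time, the first bound reads $\|K(t)\|\le\frac2{E_p}\sum_{a\ne a'}\frac{\|V-W\|}{|\lambda_a-\lambda_{a'}|}$.) 4. For every $\varepsilon>0$ there is $E_0>0$ such that $\|U(T)\Pi_0-\bar U(T)\Pi_0\|<\varepsilon$ for all $E_p\ge E_0$. -/

import Mathlib

open Set Matrix
open scoped BigOperators

noncomputable section

namespace PenaltyCode

/-! ### Physical qubits, Pauli operators and the `[[6k,2k,2]]` subsystem code -/

/-- The three physical qubits that belong to one logical qubit. -/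
inductive Site where
  | B | L | R
  deriving DecidableEq

instance : Fintype Site := ⟨{Site.B, Site.L, Site.R}, fun x => by cases x <;> simp⟩

/-- The `6k` physical qubits `B_i, L_i, R_i`, `i` ranging over the `2k` logical qubits. -/
abbrev Qubit (k : ℕ) : Type := Site × Fin (2 * k)

/-- Labels of the computational basis of the `6k` qubits. -/
abbrev Bits (k : ℕ) : Type := Qubit k → ZMod 2

/-- Operators of the system in the computational basis. -/
abbrev SysOp (k : ℕ) : Type := Matrix (Bits k) (Bits k) ℂ

/-- The group of unitary operators of the system. -/
abbrev SysU (k : ℕ) : Type := Matrix.unitaryGroup (Bits k) ℂ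

/-- The X-type Pauli operator `∏_{q, v q = 1} X_q`, that is `|y⟩ ↦ |y + v⟩`. -/
def xMat {k : ℕ} (v : Bits k) : SysOp k :=
  Matrix.of fun x y => if x = y + v then 1 else 0

/-- The Z-type Pauli operator `∏_{q, w q = 1} Z_q`, that is `|y⟩ ↦ (-1)^{w·y} |y⟩`. -/
def zMat {k : ℕ} (w : Bits k) : SysOp k :=
  Matrix.diagonal fun x => (-1 : ℂ) ^ (w ⬝ᵥ x).val

theorem xMat_mem {k : ℕ} (v : Bits k) : xMat v ∈ Matrix.unitaryGroup (Bits k) ℂ := by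
  rw [Matrix.mem_unitaryGroup_iff]
  ext x y
  have h : ∀ z : Bits k, (if x = z + v then (1 : ℂ) else 0) * star (if y = z + v then (1 : ℂ) else 0)
      = if z = x - v then (if x = y then 1 else 0) else 0 := by
    intro z
    by_cases h1 : z = x - v
    · subst h1
      by_cases h2 : x = y
      · simp [h2]
      · simp [h2, Ne.symm h2]
    · have h2 : ¬ x = z + v := fun h => h1 (by rw [h]; abel)
      simp [h1, h2]
  simp only [xMat, Matrix.mul_apply, Matrix.star_apply, Matrix.of_apply, Matrix.one_apply, h]
  rw [Finset.sum_ite_eq' Finset.univ (x - v)]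
  simp

theorem zMat_mem {k : ℕ} (w : Bits k) : zMat w ∈ Matrix.unitaryGroup (Bits k) ℂ := by
  rw [Matrix.mem_unitaryGroup_iff, zMat, Matrix.star_eq_conjTranspose,
    Matrix.diagonal_conjTranspose, Matrix.diagonal_mul_diagonal, ← Matrix.diagonal_one]
  congr 1
  ext x
  simp [← mul_pow]

def xOp {k : ℕ} (v : Bits k) : SysU k := ⟨xMat v, xMat_mem v⟩

def zOp {k : ℕ} (w : Bits k) : SysU k := ⟨zMat w, zMat_mem w⟩

/-- `X_q` -/
def pX {k : ℕ} (q : Qubit k) : SysU k := xOp (Pi.single q 1)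

/-- `Z_q` -/
def pZ {k : ℕ} (q : Qubit k) : SysU k := zOp (Pi.single q 1)

/-- The three Pauli matrices. -/
inductive Pauli where
  | X | Y | Z
  deriving DecidableEq

instance : Fintype Pauli := ⟨{Pauli.X, Pauli.Y, Pauli.Z}, fun x => by cases x <;> simp⟩

/-- The Pauli operator `σ` on the qubit `q`; here `Y = i X Z`. -/
def pauli {k : ℕ} (q : Qubit k) : Pauli → SysOp k
  | Pauli.X => (pX q : SysOp k)
  | Pauli.Y => Complex.I • ((pX q : SysOp k) * (pZ q : SysOp k))
  | Pauli.Z => (pZ q : SysOp k)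

/-- The gauge group, generated by `X_{B_i} X_{R_i}`, `X_{L_i} X_{L_{i+1}}`, `Z_{B_i} Z_{L_i}`,
`Z_{R_i} Z_{R_{i+1}}`. -/
def gaugeGroup (k : ℕ) : Subgroup (SysU k) :=
  Subgroup.closure
    ({g | ∃ i, g = pX (Site.B, i) * pX (Site.R, i)} ∪
     {g | ∃ i j : Fin (2 * k), i.val + 1 = j.val ∧ g = pX (Site.L, i) * pX (Site.L, j)} ∪
     {g | ∃ i, g = pZ (Site.B, i) * pZ (Site.L, i)} ∪
     {g | ∃ i j : Fin (2 * k), i.val + 1 = j.val ∧ g = pZ (Site.R, i) * pZ (Site.R, j)})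

/-- `g` is a product of operators `X_q`, or a product of operators `Z_q`. -/
def IsXOrZType {k : ℕ} (g : SysU k) : Prop := (∃ v, g = xOp v) ∨ (∃ w, g = zOp w)

/-- The bare logical operators `X̄_i = X_{B_i} X_{L_i}`. -/
def logX {k : ℕ} (i : Fin (2 * k)) : SysOp k := (pX (Site.B, i) * pX (Site.L, i) : SysU k)

/-- The bare logical operators `Z̄_i = Z_{B_i} Z_{R_i}`. -/
def logZ {k : ℕ} (i : Fin (2 * k)) : SysOp k := (pZ (Site.B, i) * pZ (Site.R, i) : SysU k)

/-- The gauge operators `g^x_{ij} = X_{L_i} X_{L_j}`. -/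
def gX {k : ℕ} (i j : Fin (2 * k)) : SysOp k := (pX (Site.L, i) * pX (Site.L, j) : SysU k)

/-- The gauge operators `g^z_{ij} = Z_{R_i} Z_{R_j}`. -/
def gZ {k : ℕ} (i j : Fin (2 * k)) : SysOp k := (pZ (Site.R, i) * pZ (Site.R, j) : SysU k)

/-! ### Penalty Hamiltonian and its spectral projectors -/

/-- `H_p = - ∑_{g ∈ G'} g`. -/
def penalty {k : ℕ} (G' : Finset (SysU k)) : SysOp k := -∑ g ∈ G', (g : SysOp k)

/-- The (finite) set of the eigenvalues. -/
def eigs {k : ℕ} (H : SysOp k) : Finset ℝ := (Matrix.finite_real_spectrum (A := H)).toFinset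

/-- The orthogonal projector to the eigenspace of `H` at `μ`. -/
def eigProj {k : ℕ} (H : SysOp k) (μ : ℝ) : SysOp k :=
  (Matrix.toEuclideanCLM (n := Bits k) (𝕜 := ℂ)).symm
    (Module.End.eigenspace
      (Matrix.toEuclideanCLM (n := Bits k) (𝕜 := ℂ) H).toLinearMap (μ : ℂ)).starProjection

/-- The orthogonal projector to the ground subspace of `H`. -/
def groundProj {k : ℕ} (H : SysOp k) : SysOp k := eigProj H (sInf (spectrum ℝ H))

/-- `∑_{a ≠ a'} 1 / |λ_a - λ_{a'}|` over the ordered pairs of distinct eigenvalues. -/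
def gapSum {k : ℕ} (H : SysOp k) : ℝ :=
  ∑ μ ∈ eigs H, ∑ ν ∈ (eigs H).erase μ, 1 / |μ - ν|

/-- `∑_a Π_a M Π_a` -/
def diagPart {k : ℕ} (H M : SysOp k) : SysOp k :=
  ∑ μ ∈ eigs H, eigProj H μ * M * eigProj H μ

/-- `∑_{a ≠ a'} Π_a M Π_{a'}` -/
def offDiagPart {k : ℕ} (H M : SysOp k) : SysOp k :=
  ∑ μ ∈ eigs H, ∑ ν ∈ (eigs H).erase μ, eigProj H μ * M * eigProj H ν

/-! ### Computational Hamiltonians -/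

/-- Time-dependent coefficients of
`∑ a_i X_i + ∑ b_i Z_i + ∑ c_ij X_i X_j + ∑ d_ij Z_i Z_j` on `n` qubits. -/
structure Couplings (n : ℕ) where
  a : Fin n → ℝ → ℝ
  b : Fin n → ℝ → ℝ
  c : Fin n → Fin n → ℝ → ℝ
  d : Fin n → Fin n → ℝ → ℝ

/-- All coefficients are of class `C^m` on `[0, T]`. -/
def Couplings.Smooth {n : ℕ} (f : Couplings n) (m : ℕ) (T : ℝ) : Prop :=
  (∀ i, ContDiffOn ℝ m (f.a i) (Icc 0 T)) ∧ (∀ i, ContDiffOn ℝ m (f.b i) (Icc 0 T)) ∧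
  (∀ i j, ContDiffOn ℝ m (f.c i j) (Icc 0 T)) ∧ (∀ i j, ContDiffOn ℝ m (f.d i j) (Icc 0 T))

/-- `c'_ij = c_ij / α^x_ij`, `d'_ij = d_ij / α^z_ij`. -/
def Couplings.rescale {n : ℕ} (f : Couplings n) (αx αz : Fin n → Fin n → ℝ) : Couplings n where
  a := f.a
  b := f.b
  c := fun i j t => f.c i j t / αx i j
  d := fun i j t => f.d i j t / αz i j

/-- The encoded Hamiltonian `H̄_s(t)`, built from the bare logical operators. -/
def barH {k : ℕ} (f : Couplings (2 * k)) (t : ℝ) : SysOp k :=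
  ∑ i, (f.a i t : ℂ) • logX i + ∑ i, (f.b i t : ℂ) • logZ i
    + ∑ i, ∑ j, (f.c i j t : ℂ) • (logX i * logX j)
    + ∑ i, ∑ j, (f.d i j t : ℂ) • (logZ i * logZ j)

/-- The two-local Hamiltonian `∑ a_i X_{L_i} X_{B_i} + ∑ b_i Z_{B_i} Z_{R_i}
+ ∑ c_ij X_{B_i} X_{B_j} + ∑ d_ij Z_{B_i} Z_{B_j}`. -/
def hatH {k : ℕ} (f : Couplings (2 * k)) (t : ℝ) : SysOp k :=
  ∑ i, (f.a i t : ℂ) • ((pX (Site.L, i) * pX (Site.B, i) : SysU k) : SysOp k)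
    + ∑ i, (f.b i t : ℂ) • ((pZ (Site.B, i) * pZ (Site.R, i) : SysU k) : SysOp k)
    + ∑ i, ∑ j, (f.c i j t : ℂ) • ((pX (Site.B, i) * pX (Site.B, j) : SysU k) : SysOp k)
    + ∑ i, ∑ j, (f.d i j t : ℂ) • ((pZ (Site.B, i) * pZ (Site.B, j) : SysU k) : SysOp k)

/-! ### Evolutions in a normed algebra of operators -/

section Evolution

variable {A : Type*} [NormedRing A] [NormedAlgebra ℂ A]

/-- `U` is the evolution generated by `H` on `[0, T]`, the time-ordered exponential of
`-i ∫ H`: the solution of `U' = -i H U`, `U(0) = 1`. -/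
def IsEvolution (T : ℝ) (H U : ℝ → A) : Prop :=
  U 0 = 1 ∧ ∀ t ∈ Icc 0 T, HasDerivWithinAt U (-(Complex.I • (H t * U t))) (Icc 0 T) t

/-- `∫_0^t e^{i h τ} F(τ) e^{-i h τ} P dτ` -/
def rotInt (h : A) (F : ℝ → A) (P : A) (t : ℝ) : A :=
  ∫ τ in (0 : ℝ)..t, NormedSpace.exp ((Complex.I * τ) • h) * F τ
    * NormedSpace.exp (-(Complex.I * τ) • h) * P

/-- The supremum over the time interval `[0, T]`. -/
def supT (T : ℝ) (φ : ℝ → ℝ) : ℝ := ⨆ t : Icc (0 : ℝ) T, φ t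

/-- `sup_{t ∈ [0, T]} ‖F'(t)‖` -/
def supDeriv (T : ℝ) (F : ℝ → A) : ℝ := supT T fun t => ‖derivWithin F (Icc 0 T) t‖

end Evolution

/-! ### System and bath -/

section Bath

variable {E : Type*} [NormedAddCommGroup E] [InnerProductSpace ℂ E]

/-- The Hilbert space `(ℂ²)^{⊗ 6k} ⊗ E` of system and bath: a vector `∑_x |x⟩ ⊗ ψ x` is
the family of the `ψ x : E`, with the norm `(∑_x ‖ψ x‖²)^{1/2}`. -/
abbrev Joint (k : ℕ) (E : Type*) : Type _ := PiLp 2 (fun _ : Bits k => E)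

/-- Bounded operators of system and bath, with the operator norm. -/
abbrev JointOp (k : ℕ) (E : Type*) [NormedAddCommGroup E] [InnerProductSpace ℂ E] : Type _ :=
  Joint k E →L[ℂ] Joint k E

instance instNormedRingJointOp (k : ℕ) : NormedRing (JointOp k E) :=
  ContinuousLinearMap.toNormedRing

instance instNormedAlgebraJointOp (k : ℕ) : NormedAlgebra ℂ (JointOp k E) :=
  ContinuousLinearMap.toNormedAlgebra

/-- The operator `A ⊗ B`. -/
def tens {k : ℕ} (A : SysOp k) (B : E →L[ℂ] E) : JointOp k E :=
  (PiLp.continuousLinearEquiv 2 ℂ (fun _ : Bits k => E)).symm.toContinuousLinearMap ∘L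
    ContinuousLinearMap.pi fun x =>
      ∑ y, A x y • (B ∘L PiLp.proj 2 (𝕜 := ℂ) (fun _ : Bits k => E) y)

theorem tens_apply {k : ℕ} (A : SysOp k) (B : E →L[ℂ] E) (ψ : Joint k E) (x : Bits k) :
    tens A B ψ x = ∑ y, A x y • B (ψ y) := by
  simp [tens]

/-- The system operator `A`, read on system and bath as `A ⊗ 1`. -/
def onSys (E : Type*) [NormedAddCommGroup E] [InnerProductSpace ℂ E] {k : ℕ} (A : SysOp k) :
    JointOp k E := tens A (ContinuousLinearMap.id ℂ E)

/-- The bath operator `B`, read on system and bath as `1 ⊗ B`. -/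
def onBath (k : ℕ) (B : E →L[ℂ] E) : JointOp k E := tens 1 B

/-- The one-local interaction `H_SB = ∑_q ∑_{σ ∈ {X, Y, Z}} σ_q ⊗ B_{q,σ}`. -/
def interaction {k : ℕ} (B : Qubit k → Pauli → E →L[ℂ] E) : JointOp k E :=
  ∑ q, ∑ s, tens (pauli q s) (B q s)

/-- The physical generator `Ĥ_s(t) + E_p H_p + H_B + H_SB`. -/
def physH {k : ℕ} (Hp : SysOp k) (Ep : ℝ) (f : Couplings (2 * k)) (HB : E →L[ℂ] E)
    (B : Qubit k → Pauli → E →L[ℂ] E) (t : ℝ) : JointOp k E :=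
  onSys E (hatH f t) + (Ep : ℂ) • onSys E Hp + onBath k HB + interaction B

/-- The decoupled generator `H̄_s(t) + H_B + E_p H_p`. -/
def decH {k : ℕ} (Hp : SysOp k) (Ep : ℝ) (f : Couplings (2 * k)) (HB : E →L[ℂ] E)
    (t : ℝ) : JointOp k E :=
  onSys E (barH f t) + onBath k HB + (Ep : ℂ) • onSys E Hp

/-- `H_0(t) = ∑_a Π_a Ĥ_s(t) Π_a + H_B` -/
def opH0 {k : ℕ} (Hp : SysOp k) (f : Couplings (2 * k)) (HB : E →L[ℂ] E) (t : ℝ) :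
    JointOp k E :=
  onSys E (diagPart Hp (hatH f t)) + onBath k HB

/-- `V(t) = ∑_{a ≠ a'} Π_a Ĥ_s(t) Π_{a'} + H_SB` -/
def opV {k : ℕ} (Hp : SysOp k) (f : Couplings (2 * k))
    (B : Qubit k → Pauli → E →L[ℂ] E) (t : ℝ) : JointOp k E :=
  onSys E (offDiagPart Hp (hatH f t)) + interaction B

/-- `W(t) = Π_0 V(t) Π_0` -/
def opW {k : ℕ} (Hp : SysOp k) (f : Couplings (2 * k))
    (B : Qubit k → Pauli → E →L[ℂ] E) (t : ℝ) : JointOp k E :=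
  onSys E (groundProj Hp) * opV Hp f B t * onSys E (groundProj Hp)

/-- `K(t) = ∫_0^t e^{i E_p H_p τ} (V(τ) - W(τ)) e^{-i E_p H_p τ} Π_0 dτ` -/
def opK {k : ℕ} (Hp : SysOp k) (Ep : ℝ) (f : Couplings (2 * k))
    (B : Qubit k → Pauli → E →L[ℂ] E) (t : ℝ) : JointOp k E :=
  rotInt ((Ep : ℂ) • onSys E Hp)
    (fun τ => (opV Hp f B τ - opW Hp f B τ)) (onSys E (groundProj Hp)) t

/-- `2 sup_t ‖V(t) - W(t)‖ + T sup_t ‖(d/dt) (V(t) - W(t))‖` -/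
def strength {k : ℕ} (Hp : SysOp k) (T : ℝ) (f : Couplings (2 * k))
    (B : Qubit k → Pauli → E →L[ℂ] E) : ℝ :=
  2 * supT T (fun t => ‖opV Hp f B t - opW Hp f B t‖)
    + T * supDeriv T (fun t => opV Hp f B t - opW Hp f B t)

end Bath

end PenaltyCode

end

open PenaltyCode

/-! The argument has an algebraic half about the ground space of the penalty and an analytic half
about averaging fast oscillations.

Algebra. Write `-H_p` as a sum of operators `X_v` (`v ∈ Vx`) and `Z_w` (`w ∈ Vz`). In the
computational basis its off-diagonal entries are nonnegative, so Perron–Frobenius applies: the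
modulus of a top eigenvector is again one (`IsEig.abs`), a zero spreads over a whole coset of `span
Vx`, and on each coset the top eigenvector is unique up to a factor. The all-ones vector lies in
both parts of the gauge group and is orthogonal to both, so `X` and `Z` on all qubits are
stabilizers, and they fix the ground space pointwise. Every one-qubit Pauli operator anticommutes
with one of them; hence `Π₀ H_SB Π₀ = 0`. Cosets that can carry ground vectors are exchanged by bare
logical operators (`splits_of_span`), which commute with `H_p`. Thus an X-type gauge operator has
the same positive expectation on all of them, and polarization turns this into `Π₀ g Π₀ = α Π₀`; the
Hadamard transform gives the Z case. Since `X_{B_i} X_{B_j}` is a product of two logical operators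
and a gauge operator, dividing the coupling by `α` reproduces the encoded Hamiltonian on the ground
space.

Analysis. The algebra makes `W = 0`, so `V` only couples the ground space to excited levels. In the
interaction picture of `E_p H_p`, adding the first-order correction `K` to the overlap of the two
evolutions cancels the `V` term of its derivative, leaving `[H₀, K]` and a product of the rotated
`V` with `K` (`norm_evolution_sub_le`). `K` is a finite sum of integrals with frequencies `E_p (λ_a
- λ_0)`, `a ≠ 0`. Integration by parts makes it `O(1/E_p)` for `C¹` couplings; for merely continuous
ones a Riemann–Lebesgue lemma, uniform in the upper limit, makes it small. -/

noncomputable section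

namespace PenaltyCode

section

/-! ### Signs, and the action of Pauli operators on vectors -/

/-- The nontrivial character of `ZMod 2`. -/
def sgn (a : ZMod 2) : ℂ := (-1) ^ a.val

@[simp] lemma sgn_zero : sgn 0 = 1 := by simp [sgn]

@[simp] lemma sgn_one : sgn 1 = -1 := by simp [sgn, ZMod.val_one]

lemma zmod_two_cases (a : ZMod 2) : a = 0 ∨ a = 1 := by
  revert a; decide

lemma sgn_add (a b : ZMod 2) : sgn (a + b) = sgn a * sgn b := by
  have h : (1 : ZMod 2) + 1 = 0 := by decide
  rcases zmod_two_cases a with rfl | rfl <;> rcases zmod_two_cases b with rfl | rfl <;> simp [h]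

lemma sgn_mul_self (a : ZMod 2) : sgn a * sgn a = 1 := by
  rcases zmod_two_cases a with rfl | rfl <;> simp

lemma sgn_eq_one_iff (a : ZMod 2) : sgn a = 1 ↔ a = 0 := by
  rcases zmod_two_cases a with rfl | rfl <;> simp
  norm_num

lemma star_sgn (a : ZMod 2) : star (sgn a) = sgn a := by
  rcases zmod_two_cases a with rfl | rfl <;> simp

variable {k : ℕ}

lemma xMat_apply (v x y : Bits k) : xMat v x y = if x = y + v then 1 else 0 := rfl

lemma zMat_eq (w : Bits k) : zMat w = Matrix.diagonal fun x => sgn (w ⬝ᵥ x) := rfl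

lemma eq_add_iff_bits (x y v : Bits k) : x = y + v ↔ y = x + v := by
  constructor <;> rintro rfl <;> rw [add_assoc, ZModModule.add_self, add_zero]

lemma xMat_mulVec (v : Bits k) (φ : Bits k → ℂ) (x : Bits k) :
    (xMat v *ᵥ φ) x = φ (x + v) := by
  simp [Matrix.mulVec, dotProduct, xMat_apply, eq_add_iff_bits x _ v]

lemma zMat_mulVec (w : Bits k) (φ : Bits k → ℂ) (x : Bits k) :
    (zMat w *ᵥ φ) x = sgn (w ⬝ᵥ x) * φ x := by
  simp [zMat_eq, Matrix.mulVec_diagonal]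

@[simp] lemma xMat_zero : xMat (0 : Bits k) = 1 := by
  ext x y; simp [xMat_apply, Matrix.one_apply]

@[simp] lemma zMat_zero : zMat (0 : Bits k) = 1 := by
  simp [zMat_eq]

lemma xMat_mul (u v : Bits k) : xMat u * xMat v = xMat (u + v) := by
  ext x y
  simp only [Matrix.mul_apply, xMat_apply, mul_ite, mul_one, mul_zero, Finset.sum_ite_eq',
    Finset.mem_univ, if_true, add_assoc, add_comm u v]

lemma zMat_mul (u v : Bits k) : zMat u * zMat v = zMat (u + v) := by
  simp [zMat_eq, Matrix.diagonal_mul_diagonal, add_dotProduct, sgn_add]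

lemma zMat_mul_xMat (w v : Bits k) : zMat w * xMat v = sgn (w ⬝ᵥ v) • (xMat v * zMat w) := by
  ext x y
  simp only [zMat_eq, Matrix.diagonal_mul, Matrix.mul_diagonal, Matrix.smul_apply, xMat_apply,
    smul_eq_mul]
  split_ifs with h
  · subst h; simp [dotProduct_add, sgn_add, mul_comm]
  · simp

lemma xMat_conjTranspose (v : Bits k) : (xMat v)ᴴ = xMat v := by
  ext x y
  rw [Matrix.conjTranspose_apply, xMat_apply, xMat_apply, apply_ite star, star_one, star_zero]
  exact if_congr (eq_add_iff_bits y x v) rfl rfl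

lemma zMat_conjTranspose (w : Bits k) : (zMat w)ᴴ = zMat w := by
  rw [zMat_eq, Matrix.diagonal_conjTranspose]
  congr 1
  ext x
  exact star_sgn _

/-! ### Perron–Frobenius theory of `∑ X_v + ∑ Z_w` -/

/-- `∑_{v ∈ Vx} X_v + ∑_{w ∈ Vz} Z_w` -/
def pauliSum (Vx Vz : Finset (Bits k)) : SysOp k := ∑ v ∈ Vx, xMat v + ∑ w ∈ Vz, zMat w

lemma pauliSum_mulVec (Vx Vz : Finset (Bits k)) (φ : Bits k → ℂ) (x : Bits k) :
    (pauliSum Vx Vz *ᵥ φ) x = ∑ v ∈ Vx, φ (x + v) + (∑ w ∈ Vz, sgn (w ⬝ᵥ x)) * φ x := by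
  simp [pauliSum, Matrix.add_mulVec, Matrix.sum_mulVec, xMat_mulVec, zMat_mulVec,
    Finset.sum_mul]

section Perron

open scoped ComplexOrder

/-- `l` bounds the spectrum of `pauliSum Vx Vz` from above. -/
def IsTop (Vx Vz : Finset (Bits k)) (l : ℝ) : Prop :=
  ((l : ℂ) • (1 : SysOp k) - pauliSum Vx Vz).PosSemidef

/-- `φ` is a (possibly zero) eigenvector of `pauliSum Vx Vz` for `l`. -/
def IsEig (Vx Vz : Finset (Bits k)) (l : ℝ) (φ : Bits k → ℂ) : Prop :=
  pauliSum Vx Vz *ᵥ φ = (l : ℂ) • φ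

lemma isEig_iff_sub {Vx Vz : Finset (Bits k)} {l : ℝ} {φ : Bits k → ℂ} :
    IsEig Vx Vz l φ ↔ ((l : ℂ) • (1 : SysOp k) - pauliSum Vx Vz) *ᵥ φ = 0 := by
  rw [IsEig, Matrix.sub_mulVec, Matrix.smul_mulVec, Matrix.one_mulVec, sub_eq_zero, eq_comm]

variable {Vx Vz : Finset (Bits k)} {l : ℝ} {φ ψ : Bits k → ℂ}

lemma IsEig.sub (h : IsEig Vx Vz l φ) (h' : IsEig Vx Vz l ψ) : IsEig Vx Vz l (φ - ψ) := by
  rw [IsEig, Matrix.mulVec_sub, h, h', smul_sub]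

lemma IsEig.smul (h : IsEig Vx Vz l φ) (c : ℂ) : IsEig Vx Vz l (c • φ) := by
  rw [IsEig, Matrix.mulVec_smul, h, smul_comm]

lemma IsEig.of_commute {A : SysOp k} (hA : pauliSum Vx Vz * A = A * pauliSum Vx Vz)
    (h : IsEig Vx Vz l φ) : IsEig Vx Vz l (A *ᵥ φ) := by
  rw [IsEig, Matrix.mulVec_mulVec, hA, ← Matrix.mulVec_mulVec, h, Matrix.mulVec_smul]

/-- Such translations are the symmetries that carry top eigenvectors from one coset of `span Vx` to
another. -/
lemma pauliSum_mul_xMat {u : Bits k} (hu : ∀ w ∈ Vz, w ⬝ᵥ u = 0) :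
    pauliSum Vx Vz * xMat u = xMat u * pauliSum Vx Vz := by
  simp only [pauliSum, add_mul, mul_add, Finset.sum_mul, Finset.mul_sum]
  exact congrArg₂ (· + ·)
    (Finset.sum_congr rfl fun v _ => by rw [xMat_mul, xMat_mul, add_comm])
    (Finset.sum_congr rfl fun w hw => by rw [zMat_mul_xMat, hu w hw, sgn_zero, one_smul])

/-- The pointwise absolute value of a top eigenvector is a top eigenvector. -/
lemma IsEig.abs (hl : IsTop Vx Vz l) (h : IsEig Vx Vz l φ) :
    IsEig Vx Vz l (fun x => (‖φ x‖ : ℂ)) := by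
  obtain ⟨N, hN⟩ : ∃ N : SysOp k, N = (l : ℂ) • (1 : SysOp k) - pauliSum Vx Vz := ⟨_, rfl⟩
  have hNp : N.PosSemidef := hN ▸ hl
  have key : ∀ χ : Bits k → ℂ, star χ ⬝ᵥ N *ᵥ χ = ∑ x, star (χ x) *
      ((l : ℂ) * χ x - (∑ v ∈ Vx, χ (x + v) + (∑ w ∈ Vz, sgn (w ⬝ᵥ x)) * χ x)) := by
    intro χ
    refine Finset.sum_congr rfl fun x _ => ?_
    rw [hN, Matrix.sub_mulVec, Matrix.smul_mulVec, Matrix.one_mulVec, Pi.sub_apply,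
      pauliSum_mulVec]
    rfl
  have h0 : star φ ⬝ᵥ N *ᵥ φ = 0 := by
    rw [hN, isEig_iff_sub.1 h, dotProduct_zero]
  rw [isEig_iff_sub, ← hN, ← hNp.dotProduct_mulVec_zero_iff]
  have hpos := (posSemidef_iff_dotProduct_mulVec.1 hNp).2 (fun x => (‖φ x‖ : ℂ))
  -- Positivity gives one inequality. For the other, compare with the form at `φ`, which is zero:
  -- diagonal terms depend only on `‖φ x‖` (`e1`), and the hopping terms, which enter with a minus
  -- sign, can only grow under absolute values (`e2`).
  refine le_antisymm ?_ hpos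
  rw [Complex.le_def] at hpos ⊢
  refine ⟨?_, hpos.2.symm⟩
  rw [← h0, key, key, Complex.re_sum, Complex.re_sum]
  refine Finset.sum_le_sum fun x _ => ?_
  have e1 : ∀ d : ℂ, star (φ x) * (d * φ x) = star (‖φ x‖ : ℂ) * (d * (‖φ x‖ : ℂ)) := by
    intro d
    have : star (φ x) * φ x = (‖φ x‖ : ℂ) ^ 2 := Complex.conj_mul' (φ x)
    calc star (φ x) * (d * φ x) = d * (star (φ x) * φ x) := by ring
      _ = _ := by rw [this]; simp; ring
  rw [mul_sub, mul_sub, mul_add, mul_add, e1, e1]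
  simp only [Complex.sub_re, Complex.add_re]
  have e2 : (star (φ x) * ∑ v ∈ Vx, φ (x + v)).re
      ≤ (star (‖φ x‖ : ℂ) * ∑ v ∈ Vx, (‖φ (x + v)‖ : ℂ)).re := by
    rw [Finset.mul_sum, Finset.mul_sum, Complex.re_sum, Complex.re_sum]
    refine Finset.sum_le_sum fun v _ => (Complex.re_le_norm _).trans ?_
    simp
  linarith

/-- A top eigenvector that vanishes at a point vanishes on its coset. -/
lemma IsEig.eq_zero_of_mem_span (hl : IsTop Vx Vz l) (h : IsEig Vx Vz l φ) {s : Bits k}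
    (hs : s ∈ Submodule.span (ZMod 2) (Vx : Set (Bits k))) :
    ∀ {x : Bits k}, φ x = 0 → φ (x + s) = 0 := by
  have step : ∀ v ∈ Vx, ∀ x, φ x = 0 → φ (x + v) = 0 := by
    intro v hv x hx
    -- At a zero of `φ` the eigenvalue equation for `|φ|` says that a sum of nonnegative numbers
    -- vanishes.
    have h1 := congrFun (h.abs hl) x
    rw [pauliSum_mulVec] at h1
    simp only [hx, norm_zero, Complex.ofReal_zero, mul_zero, add_zero, Pi.smul_apply,
      smul_eq_mul] at h1
    rw [← Complex.ofReal_sum, Complex.ofReal_eq_zero,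
      Finset.sum_eq_zero_iff_of_nonneg fun _ _ => norm_nonneg _] at h1
    exact norm_eq_zero.1 (h1 v hv)
  induction hs using Submodule.span_induction with
  | mem v hv => exact fun {x} => step v hv x
  | zero => intro x hx; simpa using hx
  | add a b _ _ ha hb => intro x hx; rw [← add_assoc]; exact hb (ha hx)
  | smul c a _ ha =>
    intro x hx
    rcases zmod_two_cases c with rfl | rfl
    · simpa using hx
    · simpa using ha hx

/-- On a coset, a top eigenvector is determined up to a factor. -/
lemma IsEig.eq_smul (hl : IsTop Vx Vz l) (h : IsEig Vx Vz l φ) (h' : IsEig Vx Vz l ψ)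
    {x : Bits k} (hx : ψ x ≠ 0) {s : Bits k}
    (hs : s ∈ Submodule.span (ZMod 2) (Vx : Set (Bits k))) :
    φ (x + s) = φ x / ψ x * ψ (x + s) := by
  have h0 := (h.sub (h'.smul (φ x / ψ x))).eq_zero_of_mem_span hl hs (x := x)
    (by simp [hx])
  simpa [sub_eq_zero] using h0

/-- A gauge operator of X-type that commutes with all others fixes the top eigenvectors. -/
lemma IsEig.xMat_stab (hl : IsTop Vx Vz l) (h : IsEig Vx Vz l φ) {u : Bits k}
    (hs : u ∈ Submodule.span (ZMod 2) (Vx : Set (Bits k))) (hu : ∀ w ∈ Vz, w ⬝ᵥ u = 0) :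
    xMat u *ᵥ φ = φ := by
  have ha := h.abs hl
  have hxa := ha.of_commute (pauliSum_mul_xMat (Vx := Vx) hu)
  ext x
  rw [xMat_mulVec]
  by_cases hx : φ x = 0
  · rw [hx, h.eq_zero_of_mem_span hl hs hx]
  have hax : (‖φ x‖ : ℂ) ≠ 0 := by simpa using hx
  have huu : x + u + u = x := by rw [add_assoc, ZModModule.add_self, add_zero]
  -- `X_u |φ|` is a multiple of `|φ|` on the coset; since `X_u` is an involution the factor squares
  -- to one, and it is positive.
  have h1 := hxa.eq_smul hl ha hax hs
  simp only [xMat_mulVec, huu] at h1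
  have h2 : ‖φ (x + u)‖ = ‖φ x‖ := by
    rw [div_mul_eq_mul_div, eq_comm, div_eq_iff hax] at h1
    have h3 : ‖φ (x + u)‖ * ‖φ (x + u)‖ = ‖φ x‖ * ‖φ x‖ := by exact_mod_cast h1
    exact (mul_self_inj (norm_nonneg _) (norm_nonneg _)).1 h3
  -- The phase of `φ` is constant on the coset, so equal moduli mean equal values.
  have h4 := h.eq_smul hl ha hax hs
  simp only [h2] at h4
  rw [h4, div_mul_cancel₀ _ hax]

end Perron

end

section

variable {k : ℕ} {Vx Vz : Finset (Bits k)} {l : ℝ} {φ ψ : Bits k → ℂ}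

/-! ### The Hadamard transform, which exchanges X-type and Z-type -/

/-- The (unnormalized) Hadamard transform of all qubits. -/
def had (k : ℕ) : SysOp k := Matrix.of fun x y => sgn (x ⬝ᵥ y)

lemma had_apply (x y : Bits k) : had k x y = sgn (x ⬝ᵥ y) := rfl

lemma had_conjTranspose : (had k)ᴴ = had k := by
  ext x y
  rw [Matrix.conjTranspose_apply, had_apply, had_apply, star_sgn, dotProduct_comm]

lemma had_mul_xMat (v : Bits k) : had k * xMat v = zMat v * had k := by
  ext x y
  rw [zMat_eq, Matrix.diagonal_mul]
  simp only [Matrix.mul_apply, xMat_apply, mul_ite, mul_one, mul_zero, Finset.sum_ite_eq',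
    Finset.mem_univ, if_true, had_apply, dotProduct_add, sgn_add]
  rw [dotProduct_comm x v, mul_comm]

/-- Flipping a bit of `z` in the support of `x` permutes the summands and changes every sign. -/
lemma sum_sgn_dotProduct {x : Bits k} (hx : x ≠ 0) : ∑ z : Bits k, sgn (x ⬝ᵥ z) = 0 := by
  obtain ⟨q, hq⟩ := Function.ne_iff.1 hx
  have hq1 : x q = 1 := (zmod_two_cases (x q)).resolve_left hq
  have h := Equiv.sum_comp (Equiv.addRight (Pi.single q 1 : Bits k)) fun z => sgn (x ⬝ᵥ z)
  simp only [Equiv.coe_addRight, dotProduct_add, sgn_add, dotProduct_single, hq1, mul_one,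
    sgn_one, mul_neg, Finset.sum_neg_distrib] at h
  exact self_eq_neg.1 h.symm

lemma had_mul_had : had k * had k = (Fintype.card (Bits k) : ℂ) • 1 := by
  ext x y
  rw [Matrix.mul_apply, Matrix.smul_apply, Matrix.one_apply]
  have h : ∀ z, had k x z * had k z y = sgn ((x + y) ⬝ᵥ z) := fun z => by
    rw [had_apply, had_apply, add_dotProduct, sgn_add, dotProduct_comm z y]
  simp only [h]
  split_ifs with hxy
  · subst hxy
    simp [ZModModule.add_self]
  · rw [sum_sgn_dotProduct, smul_zero]
    rwa [← ZModModule.sub_eq_add, sub_ne_zero]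

lemma card_bits_ne_zero : (Fintype.card (Bits k) : ℂ) ≠ 0 :=
  Nat.cast_ne_zero.2 Fintype.card_ne_zero

lemma had_mulVec_had (φ : Bits k → ℂ) :
    had k *ᵥ had k *ᵥ φ = (Fintype.card (Bits k) : ℂ) • φ := by
  rw [Matrix.mulVec_mulVec, had_mul_had, Matrix.smul_mulVec, Matrix.one_mulVec]

lemma had_mulVec_injective : Function.Injective fun φ : Bits k → ℂ => had k *ᵥ φ := by
  intro φ ψ h
  have h1 := congrArg (fun χ => had k *ᵥ χ) h
  simp only [had_mulVec_had] at h1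
  exact smul_right_injective _ card_bits_ne_zero h1

lemma had_mul_zMat (w : Bits k) : had k * zMat w = xMat w * had k := by
  have h := congrArg (fun A => Aᴴ) (had_mul_xMat w)
  simp only [Matrix.conjTranspose_mul, had_conjTranspose, xMat_conjTranspose,
    zMat_conjTranspose] at h
  exact h.symm

lemma had_mul_pauliSum : had k * pauliSum Vx Vz = pauliSum Vz Vx * had k := by
  simp only [pauliSum, mul_add, add_mul, Finset.mul_sum, Finset.sum_mul, had_mul_xMat,
    had_mul_zMat]
  exact add_comm _ _

section Perron

open scoped ComplexOrder

/-- Congruence by `had k` preserves positivity and, up to the positive factor `card (Bits k)`, only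
swaps the two families. -/
lemma IsTop.had (hl : IsTop Vx Vz l) : IsTop Vz Vx l := by
  have h := Matrix.PosSemidef.mul_mul_conjTranspose_same hl (PenaltyCode.had k)
  have e : PenaltyCode.had k * ((l : ℂ) • (1 : SysOp k) - pauliSum Vx Vz)
      * (PenaltyCode.had k)ᴴ
      = (Fintype.card (Bits k) : ℂ) • ((l : ℂ) • (1 : SysOp k) - pauliSum Vz Vx) := by
    rw [had_conjTranspose, mul_sub, had_mul_pauliSum, Matrix.mul_smul, Matrix.mul_one,
      sub_mul, Matrix.smul_mul, Matrix.mul_assoc, had_mul_had, Matrix.mul_smul, Matrix.mul_one,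
      smul_sub, smul_comm]
  rw [e] at h
  have h2 := h.smul (α := ℂ) (a := (Fintype.card (Bits k) : ℂ)⁻¹)
    (inv_nonneg.2 (Nat.cast_nonneg _))
  rwa [smul_smul, inv_mul_cancel₀ card_bits_ne_zero, one_smul] at h2

end Perron

lemma IsEig.had (h : IsEig Vx Vz l φ) : IsEig Vz Vx l (had k *ᵥ φ) := by
  rw [IsEig, Matrix.mulVec_mulVec, ← had_mul_pauliSum, ← Matrix.mulVec_mulVec, h,
    Matrix.mulVec_smul]

lemma IsEig.zMat_stab (hl : IsTop Vx Vz l) (h : IsEig Vx Vz l φ) {w : Bits k}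
    (hs : w ∈ Submodule.span (ZMod 2) (Vz : Set (Bits k))) (hw : ∀ v ∈ Vx, v ⬝ᵥ w = 0) :
    zMat w *ᵥ φ = φ := by
  apply had_mulVec_injective
  simp only
  rw [Matrix.mulVec_mulVec, had_mul_zMat, ← Matrix.mulVec_mulVec]
  exact h.had.xMat_stab hl.had hs hw

/-! ### Expectation of gauge operators in top eigenvectors -/

/-- The combinatorial condition under which all the cosets that carry top eigenvectors are
translates of each other by logical operators: whatever is orthogonal to the Z-stabilizers is the
sum of a vector that commutes with `Vz` and of one that is spanned by `Vx`. -/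
def Splits (Vx Vz : Finset (Bits k)) : Prop :=
  ∀ d : Bits k, (∀ w ∈ Submodule.span (ZMod 2) (Vz : Set (Bits k)), (∀ v ∈ Vx, v ⬝ᵥ w = 0) →
    w ⬝ᵥ d = 0) → ∃ u t : Bits k, (∀ w ∈ Vz, w ⬝ᵥ u = 0) ∧
      t ∈ Submodule.span (ZMod 2) (Vx : Set (Bits k)) ∧ d = u + t

/-- `X_s` maps each coset of `span Vx` to itself, so the expectation can be computed coset by coset.
On every coset where `φ` lives it is proportional to a translate of one positive reference profile
`|ψ|`, so the ratio to the squared norm is always that of the reference coset. -/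
lemma exists_expectation_xMat (hl : IsTop Vx Vz l) (hS : Splits Vx Vz)
    (h0 : IsEig Vx Vz l ψ) (hψ : ψ ≠ 0) {s : Bits k}
    (hs : s ∈ Submodule.span (ZMod 2) (Vx : Set (Bits k))) :
    ∃ α : ℝ, 0 < α ∧ ∀ φ, IsEig Vx Vz l φ →
      star φ ⬝ᵥ xMat s *ᵥ φ = α * (star φ ⬝ᵥ φ) := by
  classical
  set C := Submodule.span (ZMod 2) (Vx : Set (Bits k)) with hC
  obtain ⟨x₀, hx₀⟩ := Function.ne_iff.1 hψ
  simp only [Pi.zero_apply] at hx₀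
  set r : Bits k → ℝ := fun x => ‖ψ x‖ with hr
  have hrE : IsEig Vx Vz l (fun x => (r x : ℂ)) := h0.abs hl
  have hr0 : ∀ t ∈ C, 0 < r (x₀ + t) := by
    intro t ht
    rw [hr, norm_pos_iff]
    intro h
    apply hx₀
    have := h0.eq_zero_of_mem_span hl ht h
    rwa [add_assoc, ZModModule.add_self, add_zero] at this
  -- Squared norm and `X_s`-expectation of the reference profile on `x₀ + C`; both are positive
  -- because the profile has no zero there.
  set n : ℝ := ∑ y : C, r (x₀ + y) * r (x₀ + y) with hn
  set m : ℝ := ∑ y : C, r (x₀ + y) * r (x₀ + y + s) with hm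
  have hn0 : 0 < n := Finset.sum_pos (fun y _ => mul_pos (hr0 _ y.2) (hr0 _ y.2)) ⟨0, by simp⟩
  have hm0 : 0 < m := Finset.sum_pos (fun y _ => mul_pos (hr0 _ y.2) (by
    rw [add_assoc]; exact hr0 _ (C.add_mem y.2 hs))) ⟨0, by simp⟩
  refine ⟨m / n, div_pos hm0 hn0, fun φ hφ => ?_⟩
  -- Z-stabilizers fix top eigenvectors, so they have sign `+1` at every point of the support.
  have hperp : ∀ χ : Bits k → ℂ, IsEig Vx Vz l χ → ∀ x, χ x ≠ 0 →
      ∀ w ∈ Submodule.span (ZMod 2) (Vz : Set (Bits k)), (∀ v ∈ Vx, v ⬝ᵥ w = 0) →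
      w ⬝ᵥ x = 0 := by
    intro χ hχ x hx w hw hv
    have h := congrFun (hχ.zMat_stab hl hw hv) x
    rw [zMat_mulVec] at h
    exact (sgn_eq_one_iff _).1 (mul_right_cancel₀ hx (h.trans (one_mul _).symm))
  -- The local defect of the claimed identity; it sums to zero over each coset.
  set F : Bits k → ℂ := fun x => star (φ x) * φ (x + s) - (m / n : ℝ) * (star (φ x) * φ x)
    with hF
  have hcoset : ∀ x, ∑ y : C, F (x + y) = 0 := by
    intro x
    by_cases hx : φ x = 0
    · refine Finset.sum_eq_zero fun y _ => ?_
      simp [hF, hφ.eq_zero_of_mem_span hl y.2 hx]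
    obtain ⟨u, t, hu, ht, hd⟩ := hS (x + x₀) (fun w hw hv => by
      rw [dotProduct_add, hperp φ hφ x hx w hw hv, hperp ψ h0 x₀ hx₀ w hw hv, add_zero])
    have hxu : x + u = x₀ + t := by
      have : x = x₀ + u + t := by
        rw [add_assoc, ← hd, add_left_comm, ZModModule.add_self, add_zero]
      rw [this, add_assoc, add_comm t u, ← add_assoc, add_assoc x₀ u u, ZModModule.add_self,
        add_zero]
    -- The reference profile moved by the symmetry `X_u` is a top eigenvector that is nonzero at
    -- `x`, so `φ` is a multiple of it on `x + C`.
    have hT := hrE.of_commute (pauliSum_mul_xMat (Vx := Vx) hu)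
    have hTx : ∀ y, (xMat u *ᵥ fun x => (r x : ℂ)) (x + y) = r (x₀ + (t + y)) := by
      intro y
      rw [xMat_mulVec, add_right_comm, hxu, add_assoc]
    have hTne : (xMat u *ᵥ fun x => (r x : ℂ)) x ≠ 0 := by
      have := hTx 0
      rw [add_zero, add_zero] at this
      rw [this]
      exact_mod_cast (hr0 t ht).ne'
    obtain ⟨c, hc⟩ : ∃ c : ℂ, ∀ y ∈ C, φ (x + y) = c * r (x₀ + (t + y)) :=
      ⟨_, fun y hy => by rw [hφ.eq_smul hl hT hTne hy, hTx]⟩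
    have hFy : ∀ y : C, F (x + y) = star c * c * ((r (x₀ + (t + y)) * r (x₀ + (t + y) + s)
        - m / n * (r (x₀ + (t + y)) * r (x₀ + (t + y))) : ℝ) : ℂ) := by
      intro y
      have h1 : φ (x + y + s) = c * r (x₀ + (t + y) + s) := by
        rw [add_assoc, hc _ (C.add_mem y.2 hs)]
        simp only [add_assoc]
      rw [hF]
      simp only [h1, hc _ y.2, star_mul', Complex.star_def, Complex.conj_ofReal]
      push_cast
      ring
    simp only [hFy]
    rw [← Finset.mul_sum, ← Complex.ofReal_sum, Finset.sum_sub_distrib, ← Finset.mul_sum]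
    have hsh := fun f : Bits k → ℝ => Equiv.sum_comp (Equiv.addLeft (⟨t, ht⟩ : C))
      fun y : C => f (x₀ + y)
    have e1 := hsh fun z => r z * r (z + s)
    have e2 := hsh fun z => r z * r z
    simp only [Equiv.coe_addLeft, Submodule.coe_add] at e1 e2
    rw [e1, e2, ← hm, ← hn, div_mul_cancel₀ _ hn0.ne', sub_self, Complex.ofReal_zero, mul_zero]
  -- Summing over pairs (base point, element of `C`) counts each point `card C` times and avoids
  -- choosing coset representatives.
  have htot : (Fintype.card C : ℂ) * ∑ x, F x = 0 := by
    calc (Fintype.card C : ℂ) * ∑ x, F x = ∑ y : C, ∑ x, F (x + y) := by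
          refine Eq.trans ?_ (Finset.sum_congr rfl fun (y : C) _ =>
            Equiv.sum_comp (Equiv.addRight (y : Bits k)) F).symm
          simp
      _ = ∑ x, ∑ y : C, F (x + y) := Finset.sum_comm
      _ = 0 := Finset.sum_eq_zero fun x _ => hcoset x
  have hsum : ∑ x, F x = 0 :=
    (mul_eq_zero.1 htot).resolve_left (Nat.cast_ne_zero.2 Fintype.card_ne_zero)
  rw [hF, Finset.sum_sub_distrib, ← Finset.mul_sum, sub_eq_zero] at hsum
  simpa only [dotProduct, xMat_mulVec, Pi.star_apply] using hsum

lemma star_had_dotProduct_had (φ ψ : Bits k → ℂ) :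
    star (had k *ᵥ φ) ⬝ᵥ (had k *ᵥ ψ) = (Fintype.card (Bits k) : ℂ) * (star φ ⬝ᵥ ψ) := by
  rw [Matrix.star_mulVec, had_conjTranspose, ← Matrix.dotProduct_mulVec, had_mulVec_had,
    dotProduct_smul, smul_eq_mul]

lemma exists_expectation_zMat (hl : IsTop Vx Vz l) (hS : Splits Vz Vx)
    (h0 : IsEig Vx Vz l ψ) (hψ : ψ ≠ 0) {s : Bits k}
    (hs : s ∈ Submodule.span (ZMod 2) (Vz : Set (Bits k))) :
    ∃ α : ℝ, 0 < α ∧ ∀ φ, IsEig Vx Vz l φ →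
      star φ ⬝ᵥ zMat s *ᵥ φ = α * (star φ ⬝ᵥ φ) := by
  obtain ⟨α, hα, h⟩ := exists_expectation_xMat hl.had hS h0.had
    (fun h => hψ (had_mulVec_injective (by simpa using h))) hs
  refine ⟨α, hα, fun φ hφ => ?_⟩
  have h1 := h _ hφ.had
  rw [Matrix.mulVec_mulVec, ← had_mul_zMat, ← Matrix.mulVec_mulVec, star_had_dotProduct_had,
    star_had_dotProduct_had, mul_left_comm] at h1
  exact mul_left_cancel₀ card_bits_ne_zero h1

end

section

variable {k : ℕ} {Vx Vz : Finset (Bits k)} {l : ℝ} {φ ψ : Bits k → ℂ}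

/-! ### The gauge group in the binary representation -/

lemma sum_site {M : Type*} [AddCommMonoid M] (f : Site → M) :
    ∑ s, f s = f Site.B + (f Site.L + f Site.R) := by
  have : (Finset.univ : Finset Site) = {Site.B, Site.L, Site.R} := rfl
  rw [this, Finset.sum_insert (by decide), Finset.sum_insert (by decide), Finset.sum_singleton]

lemma dotProduct_bits (v w : Bits k) : v ⬝ᵥ w = ∑ i, v (Site.B, i) * w (Site.B, i)
    + (∑ i, v (Site.L, i) * w (Site.L, i) + ∑ i, v (Site.R, i) * w (Site.R, i)) := by
  rw [dotProduct, Fintype.sum_prod_type, sum_site]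

/-- The vectors `v` with `v_B = v_s` and `∑ v_{s'} = 0`. For `(s, s') = (R, L)` this is the X-part
of the gauge group and for `(s, s') = (L, R)` its Z-part. -/
def gaugeMod (k : ℕ) (s s' : Site) : Submodule (ZMod 2) (Bits k) where
  carrier := {v | (∀ i, v (Site.B, i) = v (s, i)) ∧ ∑ i, v (s', i) = 0}
  add_mem' := by
    rintro a b ⟨ha, ha'⟩ ⟨hb, hb'⟩
    exact ⟨fun i => by simp [ha i, hb i], by simp [Finset.sum_add_distrib, ha', hb']⟩
  zero_mem' := by simp
  smul_mem' := by
    rintro c a ⟨ha, ha'⟩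
    exact ⟨fun i => by simp [ha i], by simp [← Finset.mul_sum, ha']⟩

lemma mem_gaugeMod {s s' : Site} {v : Bits k} : v ∈ gaugeMod k s s' ↔
    (∀ i, v (Site.B, i) = v (s, i)) ∧ ∑ i, v (s', i) = 0 := Iff.rfl

/-- `(s, s')` is `(R, L)` or `(L, R)`. -/
def IsRL (s s' : Site) : Prop := (s = Site.R ∧ s' = Site.L) ∨ (s = Site.L ∧ s' = Site.R)

lemma IsRL.symm {s s' : Site} (h : IsRL s s') : IsRL s' s := by
  rcases h with ⟨rfl, rfl⟩ | ⟨rfl, rfl⟩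
  · exact Or.inr ⟨rfl, rfl⟩
  · exact Or.inl ⟨rfl, rfl⟩

/-- Neighbouring pairs telescope modulo 2, first from site `0` to any site and then between any two
sites. -/
lemma single_add_single_mem {s : Site} {D : Submodule (ZMod 2) (Bits k)}
    (h : ∀ i j : Fin (2 * k), i.val + 1 = j.val →
      Pi.single (s, i) 1 + Pi.single (s, j) 1 ∈ D) (i j : Fin (2 * k)) :
    (Pi.single (s, i) 1 + Pi.single (s, j) 1 : Bits k) ∈ D := by
  have h0 : ∀ (n : ℕ) (hn : n < 2 * k) (hz : 0 < 2 * k),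
      (Pi.single (s, ⟨0, hz⟩) 1 + Pi.single (s, ⟨n, hn⟩) 1 : Bits k) ∈ D := by
    intro n
    induction n with
    | zero => intro hn hz; rw [ZModModule.add_self]; exact D.zero_mem
    | succ n ih =>
      intro hn hz
      have := D.add_mem (ih (by omega) hz) (h ⟨n, by omega⟩ ⟨n + 1, hn⟩ rfl)
      rwa [← add_assoc, add_assoc _ _ (Pi.single (s, (⟨n, by omega⟩ : Fin (2 * k))) 1),
        ZModModule.add_self, add_zero] at this
  have hz : 0 < 2 * k := i.pos
  have := D.add_mem (h0 i i.2 hz) (h0 j j.2 hz)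
  rwa [add_add_add_comm, ZModModule.add_self, zero_add] at this

lemma gaugeMod_le (hk : 1 ≤ k) {s s' : Site} (hs : IsRL s s')
    {D : Submodule (ZMod 2) (Bits k)}
    (h1 : ∀ i, Pi.single (Site.B, i) 1 + Pi.single (s, i) 1 ∈ D)
    (h2 : ∀ i j : Fin (2 * k), i.val + 1 = j.val →
      Pi.single (s', i) 1 + Pi.single (s', j) 1 ∈ D) :
    gaugeMod k s s' ≤ D := by
  intro v hv
  obtain ⟨hv1, hv2⟩ := mem_gaugeMod.1 hv
  have i₀ : Fin (2 * k) := ⟨0, by omega⟩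
  have e : v = ∑ i, v (Site.B, i) • (Pi.single (Site.B, i) 1 + Pi.single (s, i) 1 : Bits k)
      + ∑ i, v (s', i) • (Pi.single (s', i) 1 + Pi.single (s', i₀) 1 : Bits k) := by
    -- The anchor `i₀` occurs as often as `v` has ones on `s'`, an even number of times, so it drops
    -- out.
    have e0 : ∑ i, v (s', i) • (Pi.single (s', i) 1 + Pi.single (s', i₀) 1 : Bits k)
        = ∑ i, v (s', i) • (Pi.single (s', i) 1 : Bits k) := by
      simp only [smul_add, Finset.sum_add_distrib, ← Finset.sum_smul, hv2, zero_smul, add_zero]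
    rw [e0]
    ext ⟨t, j⟩
    rcases hs with ⟨rfl, rfl⟩ | ⟨rfl, rfl⟩ <;> cases t <;>
      simp [Finset.sum_apply, Pi.single_apply, hv1]
  rw [e]
  exact D.add_mem (D.sum_mem fun i _ => D.smul_mem _ (h1 i))
    (D.sum_mem fun i _ => D.smul_mem _ (single_add_single_mem h2 i i₀))

/-- The parity condition holds because the number `2k` of logical qubits is even. -/
lemma one_mem_gaugeMod (s s' : Site) : (1 : Bits k) ∈ gaugeMod k s s' := by
  refine mem_gaugeMod.2 ⟨fun i => rfl, ?_⟩
  have h2 : (2 : ZMod 2) = 0 := by decide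
  simp [h2]

/-- The `B` and `s` parts cancel and the `s'` part is even. Together with `one_mem_gaugeMod` this
makes the all-ones vector a stabilizer of both types. -/
lemma gaugeMod_dotProduct_one {s s' : Site} (hs : IsRL s s') {v : Bits k}
    (hv : v ∈ gaugeMod k s s') : v ⬝ᵥ 1 = 0 := by
  obtain ⟨hv1, hv2⟩ := mem_gaugeMod.1 hv
  rw [dotProduct_bits]
  rcases hs with ⟨rfl, rfl⟩ | ⟨rfl, rfl⟩ <;>
    simp [hv1, hv2, ZModModule.add_self]

/-- Orthogonality to the all-ones stabilizer is the only consequence of the hypothesis on `d` that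
is needed: it is exactly the parity condition left over after a logical operator has repaired `d_B =
d_s`. -/
lemma splits_of_span {s s' : Site} (hs : IsRL s s')
    (hx : Submodule.span (ZMod 2) (Vx : Set (Bits k)) = gaugeMod k s s')
    (hz : Submodule.span (ZMod 2) (Vz : Set (Bits k)) = gaugeMod k s' s) : Splits Vx Vz := by
  intro d hd
  have hd1 : (1 : Bits k) ⬝ᵥ d = 0 := hd 1 (hz ▸ one_mem_gaugeMod _ _) fun v hv =>
    gaugeMod_dotProduct_one hs (hx ▸ Submodule.subset_span hv)
  rw [dotProduct_bits] at hd1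
  simp only [Pi.one_apply, one_mul] at hd1
  -- A product of bare logical operators on the pairs `(B_i, s'_i)`, chosen so that `d + u` agrees
  -- on `B` and `s`; its parity on `s'` is then `1 ⬝ᵥ d`.
  let u : Bits k := fun q => if q.1 = s then 0 else d (Site.B, q.2) + d (s, q.2)
  refine ⟨u, d + u, fun w hw => ?_, ?_, ?_⟩
  · have hw' : w ∈ gaugeMod k s' s := hz ▸ Submodule.subset_span hw
    obtain ⟨hw1, -⟩ := mem_gaugeMod.1 hw'
    rw [dotProduct_bits]
    rcases hs with ⟨rfl, rfl⟩ | ⟨rfl, rfl⟩ <;> simp [u, hw1, ZModModule.add_self]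
  · rw [hx, mem_gaugeMod]
    rcases hs with ⟨rfl, rfl⟩ | ⟨rfl, rfl⟩
    · refine ⟨fun i => ?_, ?_⟩
      · simp [u, ← add_assoc, ZModModule.add_self]
      · simp only [u, Pi.add_apply, if_neg (show Site.L ≠ Site.R by decide),
          Finset.sum_add_distrib]
        rw [← hd1]; ring
    · refine ⟨fun i => ?_, ?_⟩
      · simp [u, ← add_assoc, ZModModule.add_self]
      · simp only [u, Pi.add_apply, if_neg (show Site.R ≠ Site.L by decide),
          Finset.sum_add_distrib]
        rw [← hd1]; ring
  · rw [add_left_comm, ZModModule.add_self, add_zero]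

/-! ### Signed Pauli operators as a group -/

lemma xOp_coe (v : Bits k) : (xOp v : SysOp k) = xMat v := rfl

lemma zOp_coe (w : Bits k) : (zOp w : SysOp k) = zMat w := rfl

lemma xOp_mul (u v : Bits k) : xOp u * xOp v = xOp (u + v) :=
  Subtype.ext (xMat_mul u v)

lemma zOp_mul (u v : Bits k) : zOp u * zOp v = zOp (u + v) :=
  Subtype.ext (zMat_mul u v)

/-- The operators `± X_v Z_w` with `v ∈ A`, `w ∈ B`. -/
def pauliSubgroup (A B : Submodule (ZMod 2) (Bits k)) : Subgroup (SysU k) where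
  carrier := {g | ∃ v ∈ A, ∃ w ∈ B, ∃ a : ZMod 2,
    (g : SysOp k) = sgn a • (xMat v * zMat w)}
  mul_mem' := by
    rintro g h ⟨v, hv, w, hw, a, hg⟩ ⟨v', hv', w', hw', a', hh⟩
    refine ⟨v + v', A.add_mem hv hv', w + w', B.add_mem hw hw', a + a' + w ⬝ᵥ v', ?_⟩
    have : xMat v * zMat w * (xMat v' * zMat w')
        = sgn (w ⬝ᵥ v') • (xMat (v + v') * zMat (w + w')) := by
      rw [Matrix.mul_assoc, ← Matrix.mul_assoc (zMat w), zMat_mul_xMat, Matrix.smul_mul,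
        Matrix.mul_smul, Matrix.mul_assoc, zMat_mul, ← Matrix.mul_assoc, xMat_mul]
    rw [Matrix.UnitaryGroup.mul_val, hg, hh, Matrix.smul_mul, Matrix.mul_smul, this,
      smul_smul, smul_smul, sgn_add, sgn_add]
  one_mem' := ⟨0, A.zero_mem, 0, B.zero_mem, 0, by simp⟩
  inv_mem' := by
    rintro g ⟨v, hv, w, hw, a, hg⟩
    refine ⟨v, hv, w, hw, a + w ⬝ᵥ v, ?_⟩
    rw [Matrix.UnitaryGroup.inv_val, hg, Matrix.star_eq_conjTranspose,
      Matrix.conjTranspose_smul, Matrix.conjTranspose_mul, xMat_conjTranspose,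
      zMat_conjTranspose, star_sgn, zMat_mul_xMat, smul_smul, sgn_add]

lemma zMat_injective : Function.Injective (zMat : Bits k → SysOp k) := by
  intro w w' h
  ext q
  have h1 := congrFun (Matrix.diagonal_injective h) (Pi.single q 1)
  change sgn _ = sgn _ at h1
  rw [dotProduct_single, dotProduct_single, mul_one, mul_one] at h1
  have h2 : sgn (w q + w' q) = 1 := by rw [sgn_add, h1, sgn_mul_self]
  rw [sgn_eq_one_iff, ← ZModModule.sub_eq_add, sub_eq_zero] at h2
  exact h2

lemma xMat_mul_zMat_apply (v w x y : Bits k) :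
    (xMat v * zMat w) x y = if x = y + v then sgn (w ⬝ᵥ y) else 0 := by
  rw [zMat_eq, Matrix.mul_diagonal, xMat_apply, ite_mul, one_mul, zero_mul]

lemma eq_of_xMat_eq {v v' w : Bits k} {a : ZMod 2} (h : xMat v = sgn a • (xMat v' * zMat w)) :
    v = v' := by
  have h1 := congrFun (congrFun h v) 0
  rw [Matrix.smul_apply, xMat_mul_zMat_apply, xMat_apply, zero_add, zero_add, if_pos rfl] at h1
  by_contra hne
  simp [if_neg hne] at h1

lemma eq_of_zMat_eq {v w w' : Bits k} {a : ZMod 2} (h : zMat w = sgn a • (xMat v * zMat w')) :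
    v = 0 ∧ w = w' := by
  have h1 := congrFun (congrFun h 0) 0
  rw [Matrix.smul_apply, xMat_mul_zMat_apply, zMat_eq, Matrix.diagonal_apply_eq, zero_add,
    dotProduct_zero, dotProduct_zero, sgn_zero] at h1
  have hv : v = 0 := by
    by_contra hne
    simp [if_neg (Ne.symm hne)] at h1
  subst hv
  refine ⟨rfl, zMat_injective ?_⟩
  rw [if_pos rfl, smul_eq_mul, mul_one] at h1
  rw [h, ← h1, one_smul, xMat_zero, Matrix.one_mul]

lemma xOp_injective : Function.Injective (xOp : Bits k → SysU k) := by
  intro v v' h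
  have h1 : xMat v = xMat v' := congrArg Subtype.val h
  exact eq_of_xMat_eq (w := 0) (a := 0) (by simpa using h1)

lemma zOp_injective : Function.Injective (zOp : Bits k → SysU k) := by
  intro w w' h
  exact zMat_injective (congrArg Subtype.val h)

lemma xOp_mem_pauliSubgroup {A B : Submodule (ZMod 2) (Bits k)} {v : Bits k} :
    xOp v ∈ pauliSubgroup A B ↔ v ∈ A := by
  constructor
  · rintro ⟨v', hv', w, hw, a, h⟩
    rwa [eq_of_xMat_eq h]
  · exact fun hv => ⟨v, hv, 0, B.zero_mem, 0, by simp [xOp_coe]⟩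

lemma zOp_mem_pauliSubgroup {A B : Submodule (ZMod 2) (Bits k)} {w : Bits k} :
    zOp w ∈ pauliSubgroup A B ↔ w ∈ B := by
  constructor
  · rintro ⟨v, hv, w', hw, a, h⟩
    rwa [(eq_of_zMat_eq h).2]
  · exact fun hv => ⟨0, A.zero_mem, w, hv, 0, by simp [zOp_coe]⟩

lemma pX_mul_pX (q q' : Qubit k) : pX q * pX q' = xOp (Pi.single q 1 + Pi.single q' 1) :=
  xOp_mul _ _

lemma pZ_mul_pZ (q q' : Qubit k) : pZ q * pZ q' = zOp (Pi.single q 1 + Pi.single q' 1) :=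
  zOp_mul _ _

lemma single_pair_mem {s s' : Site} (hs : IsRL s s') (i j : Fin (2 * k)) :
    (Pi.single (s', i) 1 + Pi.single (s', j) 1 : Bits k) ∈ gaugeMod k s s' := by
  have h2 : (1 : ZMod 2) + 1 = 0 := by decide
  rw [mem_gaugeMod]
  rcases hs with ⟨rfl, rfl⟩ | ⟨rfl, rfl⟩ <;>
    simp [Pi.single_apply, Finset.sum_add_distrib, h2]

lemma single_B_mem {s s' : Site} (hs : IsRL s s') (i : Fin (2 * k)) :
    (Pi.single (Site.B, i) 1 + Pi.single (s, i) 1 : Bits k) ∈ gaugeMod k s s' := by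
  rw [mem_gaugeMod]
  rcases hs with ⟨rfl, rfl⟩ | ⟨rfl, rfl⟩ <;> simp [Pi.single_apply]

lemma isRL_RL : IsRL Site.R Site.L := Or.inl ⟨rfl, rfl⟩

lemma gaugeGroup_le : gaugeGroup k ≤
    pauliSubgroup (gaugeMod k Site.R Site.L) (gaugeMod k Site.L Site.R) := by
  rw [gaugeGroup, Subgroup.closure_le]
  rintro g (((⟨i, rfl⟩ | ⟨i, j, -, rfl⟩) | ⟨i, rfl⟩) | ⟨i, j, -, rfl⟩)
  · rw [pX_mul_pX, SetLike.mem_coe, xOp_mem_pauliSubgroup]; exact single_B_mem isRL_RL i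
  · rw [pX_mul_pX, SetLike.mem_coe, xOp_mem_pauliSubgroup]; exact single_pair_mem isRL_RL i j
  · rw [pZ_mul_pZ, SetLike.mem_coe, zOp_mem_pauliSubgroup]; exact single_B_mem isRL_RL.symm i
  · rw [pZ_mul_pZ, SetLike.mem_coe, zOp_mem_pauliSubgroup]
    exact single_pair_mem isRL_RL.symm i j

/-- A generating set of Pauli operators of pure type consists of operators `X_v` and `Z_w` where
the `v` and the `w` span the two parts of the gauge group. -/
lemma exists_penalty_eq (hk : 1 ≤ k) (G' : Finset (SysU k)) (htype : ∀ g ∈ G', IsXOrZType g)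
    (hgen : Subgroup.closure (G' : Set (SysU k)) = gaugeGroup k) :
    ∃ Vx Vz : Finset (Bits k), penalty G' = -pauliSum Vx Vz ∧
      Submodule.span (ZMod 2) (Vx : Set (Bits k)) = gaugeMod k Site.R Site.L ∧
      Submodule.span (ZMod 2) (Vz : Set (Bits k)) = gaugeMod k Site.L Site.R := by
  classical
  set Vx : Finset (Bits k) := Finset.univ.filter fun v => xOp v ∈ G' with hVx
  -- The identity is of both types. It is counted only as `X_0`, so that the sum over `G'` splits as
  -- a disjoint union; the span does not change.
  set Vz : Finset (Bits k) := Finset.univ.filter fun w => zOp w ∈ G' ∧ w ≠ 0 with hVz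
  have hdisj : Disjoint (Vx.image xOp) (Vz.image zOp) := by
    rw [Finset.disjoint_left]
    intro g h1 h2
    obtain ⟨v, hv, rfl⟩ := Finset.mem_image.1 h1
    obtain ⟨w, hw, h⟩ := Finset.mem_image.1 h2
    have h3 : zMat w = xMat v := congrArg Subtype.val h
    exact (Finset.mem_filter.1 hw).2.2
      (eq_of_zMat_eq (v := v) (w' := 0) (a := 0) (by simpa using h3)).2
  have hG : G' = Vx.image xOp ∪ Vz.image zOp := by
    ext g
    rw [Finset.mem_union, Finset.mem_image, Finset.mem_image]
    constructor
    · intro hg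
      rcases htype g hg with ⟨v, rfl⟩ | ⟨w, rfl⟩
      · exact Or.inl ⟨v, by simpa [hVx] using hg, rfl⟩
      · by_cases hw : w = 0
        · subst hw
          have h01 : (xOp 0 : SysU k) = zOp 0 := Subtype.ext (by simp [xOp_coe, zOp_coe])
          exact Or.inl ⟨0, by simpa [hVx, h01] using hg, h01⟩
        · exact Or.inr ⟨w, by simpa [hVz, hw] using hg, rfl⟩
    · rintro (⟨v, hv, rfl⟩ | ⟨w, hw, rfl⟩)
      · exact (Finset.mem_filter.1 hv).2
      · exact (Finset.mem_filter.1 hw).2.1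
  have hsub : ∀ g ∈ G', g ∈ pauliSubgroup (gaugeMod k Site.R Site.L)
      (gaugeMod k Site.L Site.R) := fun g hg =>
    gaugeGroup_le (hgen ▸ Subgroup.subset_closure hg)
  have hsup : gaugeGroup k ≤ pauliSubgroup (Submodule.span (ZMod 2) (Vx : Set (Bits k)))
      (Submodule.span (ZMod 2) (Vz : Set (Bits k))) := by
    rw [← hgen, Subgroup.closure_le]
    intro g hg
    rw [hG] at hg
    rcases Finset.mem_union.1 hg with h | h <;> obtain ⟨v, hv, rfl⟩ := Finset.mem_image.1 h
    · exact xOp_mem_pauliSubgroup.2 (Submodule.subset_span hv)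
    · exact zOp_mem_pauliSubgroup.2 (Submodule.subset_span hv)
  refine ⟨Vx, Vz, ?_, le_antisymm ?_ ?_, le_antisymm ?_ ?_⟩
  · rw [penalty, hG, Finset.sum_union hdisj, Finset.sum_image fun a _ b _ h => xOp_injective h,
      Finset.sum_image fun a _ b _ h => zOp_injective h]
    rfl
  · rw [Submodule.span_le]
    exact fun v hv => xOp_mem_pauliSubgroup.1 (hsub _ (Finset.mem_filter.1 hv).2)
  · refine gaugeMod_le hk isRL_RL (fun i => ?_) fun i j hij => ?_
    · exact xOp_mem_pauliSubgroup.1 (pX_mul_pX _ _ ▸ hsup (Subgroup.subset_closure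
        (Or.inl (Or.inl (Or.inl ⟨i, rfl⟩)))))
    · exact xOp_mem_pauliSubgroup.1 (pX_mul_pX _ _ ▸ hsup (Subgroup.subset_closure
        (Or.inl (Or.inl (Or.inr ⟨i, j, hij, rfl⟩)))))
  · rw [Submodule.span_le]
    exact fun v hv => zOp_mem_pauliSubgroup.1 (hsub _ (Finset.mem_filter.1 hv).2.1)
  · refine gaugeMod_le hk isRL_RL.symm (fun i => ?_) fun i j hij => ?_
    · exact zOp_mem_pauliSubgroup.1 (pZ_mul_pZ _ _ ▸ hsup (Subgroup.subset_closure
        (Or.inl (Or.inr ⟨i, rfl⟩))))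
    · exact zOp_mem_pauliSubgroup.1 (pZ_mul_pZ _ _ ▸ hsup (Subgroup.subset_closure
        (Or.inr ⟨i, j, hij, rfl⟩)))

end

section

variable {k : ℕ}

/-! ### Spectral projectors of a Hermitian matrix -/

lemma eigProj_mulVec (H : SysOp k) (μ : ℝ) (x : Bits k → ℂ) :
    eigProj H μ *ᵥ x = ((Module.End.eigenspace
      (Matrix.toEuclideanCLM (n := Bits k) (𝕜 := ℂ) H).toLinearMap
        (μ : ℂ)).starProjection (WithLp.toLp 2 x)).ofLp := by
  have h := Matrix.toEuclideanCLM_toLp (𝕜 := ℂ) (eigProj H μ) x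
  rw [eigProj, StarAlgEquiv.apply_symm_apply] at h
  exact (congrArg WithLp.ofLp h).symm

lemma conjTranspose_eigProj (H : SysOp k) (μ : ℝ) : (eigProj H μ)ᴴ = eigProj H μ := by
  have h := isSelfAdjoint_starProjection (Module.End.eigenspace
    (Matrix.toEuclideanCLM (n := Bits k) (𝕜 := ℂ) H).toLinearMap (μ : ℂ))
  rw [← Matrix.star_eq_conjTranspose, eigProj]
  exact ((Matrix.toEuclideanCLM (n := Bits k) (𝕜 := ℂ)).symm.map_star' _).symm.trans
    (congrArg _ h.star_eq)

lemma mem_eigenspace_iff (H : SysOp k) (μ : ℝ) (x : EuclideanSpace ℂ (Bits k)) :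
    x ∈ Module.End.eigenspace
      (Matrix.toEuclideanCLM (n := Bits k) (𝕜 := ℂ) H).toLinearMap (μ : ℂ) ↔
      H *ᵥ x.ofLp = (μ : ℂ) • x.ofLp := by
  rw [Module.End.mem_eigenspace_iff, ContinuousLinearMap.coe_coe,
    ← (WithLp.ofLp_injective 2).eq_iff, Matrix.ofLp_toEuclideanCLM]
  rfl

lemma mulVec_eigProj_mulVec (H : SysOp k) (μ : ℝ) (x : Bits k → ℂ) :
    H *ᵥ (eigProj H μ *ᵥ x) = (μ : ℂ) • (eigProj H μ *ᵥ x) := by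
  rw [eigProj_mulVec, ← mem_eigenspace_iff]
  exact Submodule.starProjection_apply_mem _ _

lemma eigProj_mulVec_of_eig {H : SysOp k} {μ : ℝ} {x : Bits k → ℂ}
    (hx : H *ᵥ x = (μ : ℂ) • x) : eigProj H μ *ᵥ x = x := by
  rw [eigProj_mulVec, Submodule.starProjection_eq_self_iff.2]
  exact (mem_eigenspace_iff H μ _).2 hx

lemma ext_mulVec {A B : SysOp k} (h : ∀ x, A *ᵥ x = B *ᵥ x) : A = B :=
  Matrix.mulVec_injective (funext h)

lemma mul_eigProj (H : SysOp k) (μ : ℝ) : H * eigProj H μ = (μ : ℂ) • eigProj H μ :=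
  ext_mulVec fun x => by
    rw [← Matrix.mulVec_mulVec, mulVec_eigProj_mulVec, Matrix.smul_mulVec]

lemma eigProj_mul {H : SysOp k} (hH : H.IsHermitian) (μ : ℝ) :
    eigProj H μ * H = (μ : ℂ) • eigProj H μ := by
  have h := congrArg (fun A => Aᴴ) (mul_eigProj H μ)
  simpa [Matrix.conjTranspose_mul, Matrix.conjTranspose_smul, conjTranspose_eigProj, hH.eq] using h

lemma eigProj_mul_self (H : SysOp k) (μ : ℝ) : eigProj H μ * eigProj H μ = eigProj H μ :=
  ext_mulVec fun x => by
    rw [← Matrix.mulVec_mulVec, eigProj_mulVec_of_eig (mulVec_eigProj_mulVec H μ x)]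

lemma eigProj_mul_eigProj {H : SysOp k} (hH : H.IsHermitian) {μ ν : ℝ} (h : μ ≠ ν) :
    eigProj H μ * eigProj H ν = 0 := by
  have h1 : eigProj H μ * H * eigProj H ν = eigProj H μ * (H * eigProj H ν) :=
    Matrix.mul_assoc _ _ _
  rw [eigProj_mul hH, mul_eigProj, Matrix.smul_mul, Matrix.mul_smul, ← sub_eq_zero,
    ← sub_smul] at h1
  exact (smul_eq_zero.1 h1).resolve_left (sub_ne_zero.2 (by exact_mod_cast h))

lemma mem_eigs {H : SysOp k} {μ : ℝ} : μ ∈ eigs H ↔ μ ∈ spectrum ℝ H :=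
  Set.Finite.mem_toFinset _

lemma sum_eigProj {H : SysOp k} (hH : H.IsHermitian) : ∑ μ ∈ eigs H, eigProj H μ = 1 := by
  have key : ∀ j, (∑ μ ∈ eigs H, eigProj H μ) *ᵥ (hH.eigenvectorBasis j).ofLp
      = (hH.eigenvectorBasis j).ofLp := by
    intro j
    have he : H *ᵥ (hH.eigenvectorBasis j).ofLp
        = ((hH.eigenvalues j : ℝ) : ℂ) • (hH.eigenvectorBasis j).ofLp :=
      hH.mulVec_eigenvectorBasis j
    have hfix := eigProj_mulVec_of_eig he
    have hmem : hH.eigenvalues j ∈ eigs H := by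
      rw [mem_eigs, hH.spectrum_real_eq_range_eigenvalues]; exact ⟨j, rfl⟩
    rw [Matrix.sum_mulVec, Finset.sum_eq_single_of_mem _ hmem, hfix]
    intro μ _ hμ
    rw [← hfix, Matrix.mulVec_mulVec, eigProj_mul_eigProj hH hμ, Matrix.zero_mulVec]
  apply (Matrix.toEuclideanCLM (n := Bits k) (𝕜 := ℂ)).injective
  rw [map_one]
  apply ContinuousLinearMap.coe_injective
  refine hH.eigenvectorBasis.toBasis.ext fun j => ?_
  rw [OrthonormalBasis.coe_toBasis, ContinuousLinearMap.coe_coe, ContinuousLinearMap.coe_coe]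
  apply WithLp.ofLp_injective 2
  exact (Matrix.ofLp_toEuclideanCLM _ _).trans (key j)

lemma eq_sum_smul_eigProj {H : SysOp k} (hH : H.IsHermitian) :
    H = ∑ μ ∈ eigs H, (μ : ℂ) • eigProj H μ := by
  conv_lhs => rw [← Matrix.mul_one H, ← sum_eigProj hH, Finset.mul_sum]
  exact Finset.sum_congr rfl fun μ _ => mul_eigProj H μ

lemma eigs_nonempty {H : SysOp k} (hH : H.IsHermitian) : (eigs H).Nonempty := by
  obtain ⟨j⟩ : Nonempty (Bits k) := inferInstance
  refine ⟨hH.eigenvalues j, ?_⟩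
  rw [mem_eigs, hH.spectrum_real_eq_range_eigenvalues]
  exact ⟨j, rfl⟩

lemma groundEnergy_mem {H : SysOp k} (hH : H.IsHermitian) : sInf (spectrum ℝ H) ∈ eigs H := by
  obtain ⟨μ, hμ⟩ := eigs_nonempty hH
  exact mem_eigs.2 (Set.Nonempty.csInf_mem ⟨μ, mem_eigs.1 hμ⟩ Matrix.finite_real_spectrum)

lemma groundEnergy_le {H : SysOp k} {μ : ℝ} (hμ : μ ∈ eigs H) : sInf (spectrum ℝ H) ≤ μ :=
  csInf_le Matrix.finite_real_spectrum.bddBelow (mem_eigs.1 hμ)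

lemma exists_ground_ne_zero {H : SysOp k} (hH : H.IsHermitian) :
    ∃ ψ : Bits k → ℂ, ψ ≠ 0 ∧ H *ᵥ ψ = ((sInf (spectrum ℝ H) : ℝ) : ℂ) • ψ := by
  have h := mem_eigs.1 (groundEnergy_mem hH)
  rw [hH.spectrum_real_eq_range_eigenvalues] at h
  obtain ⟨j, hj⟩ := h
  refine ⟨(hH.eigenvectorBasis j).ofLp, fun h0 => hH.eigenvectorBasis.toBasis.ne_zero j ?_, ?_⟩
  · rw [OrthonormalBasis.coe_toBasis]; exact WithLp.ofLp_injective 2 h0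
  · rw [hH.spectrum_real_eq_range_eigenvalues, ← hj]
    exact hH.mulVec_eigenvectorBasis j

/-! ### Ground energy, positivity and polarization -/

section Psd

open scoped ComplexOrder

lemma posSemidef_sub_groundEnergy {H : SysOp k} (hH : H.IsHermitian) :
    (H - ((sInf (spectrum ℝ H) : ℝ) : ℂ) • (1 : SysOp k)).PosSemidef := by
  have e : H - ((sInf (spectrum ℝ H) : ℝ) : ℂ) • (1 : SysOp k)
      = ∑ μ ∈ eigs H, ((μ - sInf (spectrum ℝ H) : ℝ) : ℂ) • eigProj H μ := by
    simp only [Complex.ofReal_sub, sub_smul, Finset.sum_sub_distrib]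
    rw [← Finset.smul_sum, sum_eigProj hH, ← eq_sum_smul_eigProj hH]
  rw [e]
  refine Matrix.posSemidef_sum _ fun μ hμ => ?_
  refine Matrix.PosSemidef.smul ?_ (by exact_mod_cast sub_nonneg.2 (groundEnergy_le hμ))
  have := Matrix.posSemidef_conjTranspose_mul_self (eigProj H μ)
  rwa [conjTranspose_eigProj, eigProj_mul_self] at this

/-- The difference of the two sides is Hermitian with vanishing quadratic form. It is therefore
positive semidefinite with every vector in its kernel. -/
lemma eq_smul_of_expectation {P A : SysOp k} {α : ℝ} (hP : Pᴴ = P) (hPP : P * P = P)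
    (hA : Aᴴ = A) (h : ∀ x, star (P *ᵥ x) ⬝ᵥ A *ᵥ (P *ᵥ x)
      = α * (star (P *ᵥ x) ⬝ᵥ (P *ᵥ x))) : P * A * P = (α : ℂ) • P := by
  have hq : ∀ x, star x ⬝ᵥ (P * A * P - (α : ℂ) • P) *ᵥ x = 0 := by
    intro x
    have h1 := h x
    have h2 : ∀ y, star (P *ᵥ x) ⬝ᵥ y = star x ⬝ᵥ (P *ᵥ y) := fun y => by
      rw [Matrix.star_mulVec, hP, Matrix.dotProduct_mulVec]
    rw [h2, h2] at h1
    simp only [Matrix.mulVec_mulVec, hPP] at h1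
    rw [Matrix.sub_mulVec, dotProduct_sub, Matrix.smul_mulVec, dotProduct_smul, Matrix.mul_assoc,
      h1, smul_eq_mul, sub_self]
  have hpsd : (P * A * P - (α : ℂ) • P).PosSemidef := by
    rw [posSemidef_iff_dotProduct_mulVec]
    refine ⟨?_, fun x => (hq x).ge⟩
    rw [Matrix.IsHermitian, Matrix.conjTranspose_sub, Matrix.conjTranspose_mul,
      Matrix.conjTranspose_mul, Matrix.conjTranspose_smul, hP, hA, Matrix.mul_assoc]
    simp
  rw [← sub_eq_zero]
  exact ext_mulVec fun x => by
    rw [(hpsd.dotProduct_mulVec_zero_iff x).1 (hq x), Matrix.zero_mulVec]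

end Psd

/-! ### The ground space of the penalty Hamiltonian -/

lemma pauliSum_isHermitian (Vx Vz : Finset (Bits k)) : (pauliSum Vx Vz).IsHermitian := by
  simp [Matrix.IsHermitian, pauliSum, Matrix.conjTranspose_sum, xMat_conjTranspose,
    zMat_conjTranspose]

lemma gX_eq (i j : Fin (2 * k)) :
    gX i j = xMat (Pi.single (Site.L, i) 1 + Pi.single (Site.L, j) 1) := by
  rw [gX, pX_mul_pX, xOp_coe]

lemma gZ_eq (i j : Fin (2 * k)) :
    gZ i j = zMat (Pi.single (Site.R, i) 1 + Pi.single (Site.R, j) 1) := by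
  rw [gZ, pZ_mul_pZ, zOp_coe]

lemma logX_eq (i : Fin (2 * k)) :
    logX i = xMat (Pi.single (Site.B, i) 1 + Pi.single (Site.L, i) 1) := by
  rw [logX, pX_mul_pX, xOp_coe]

lemma logZ_eq (i : Fin (2 * k)) :
    logZ i = zMat (Pi.single (Site.B, i) 1 + Pi.single (Site.R, i) 1) := by
  rw [logZ, pZ_mul_pZ, zOp_coe]

lemma zMat_one_mul_pX (q : Qubit k) :
    zMat 1 * (pX q : SysOp k) = -((pX q : SysOp k) * zMat 1) := by
  change zMat 1 * xMat _ = -(xMat _ * zMat 1)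
  rw [zMat_mul_xMat, dotProduct_single]
  simp

lemma xMat_one_mul_pZ (q : Qubit k) :
    xMat 1 * (pZ q : SysOp k) = -((pZ q : SysOp k) * xMat 1) := by
  change xMat 1 * zMat _ = -(zMat _ * xMat 1)
  rw [zMat_mul_xMat, single_dotProduct]
  simp

/-- Inserting `S` on the left of `A` and moving it through to the right gives `P A P = -P A P`. This
is error detection by a stabilizer. -/
lemma mul_mul_eq_zero_of_anticommute {P S A : SysOp k} (h1 : S * P = P) (h2 : P * S = P)
    (hA : S * A = -(A * S)) : P * A * P = 0 := by
  have h : P * A * P = -(P * A * P) :=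
    calc P * A * P = P * (S * A) * P := by rw [← Matrix.mul_assoc, h2]
      _ = -(P * A * (S * P)) := by rw [hA]; simp only [Matrix.mul_neg, Matrix.neg_mul,
          Matrix.mul_assoc]
      _ = -(P * A * P) := by rw [h1]
  ext x y
  exact self_eq_neg.1 (congrFun (congrFun h x) y)

/-- The properties of the ground projector `P` of the penalty Hamiltonian `Hp`. -/
structure GroundFacts (Hp P : SysOp k) (αx αz : Fin (2 * k) → Fin (2 * k) → ℝ) : Prop where
  herm : Hp.IsHermitian
  posX : ∀ i j, 0 < αx i j
  posZ : ∀ i j, 0 < αz i j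
  gaugeX : ∀ i j, P * gX i j * P = (αx i j : ℂ) • P
  gaugeZ : ∀ i j, P * gZ i j * P = (αz i j : ℂ) • P
  commX : ∀ i, logX i * P = P * logX i
  commZ : ∀ i, logZ i * P = P * logZ i
  local_eq_zero : ∀ q s, P * pauli q s * P = 0

/-- `A` preserves the eigenspace, so `Π A Π = A Π`; the left side is Hermitian, and taking adjoints
gives `Π A Π = Π A`. -/
lemma eigProj_comm_of_comm {H A : SysOp k} (μ : ℝ) (hA : Aᴴ = A)
    (h : H * A = A * H) : A * eigProj H μ = eigProj H μ * A := by
  have h1 : eigProj H μ * A * eigProj H μ = A * eigProj H μ := ext_mulVec fun x => by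
    rw [Matrix.mul_assoc, ← Matrix.mulVec_mulVec]
    apply eigProj_mulVec_of_eig
    rw [← Matrix.mulVec_mulVec, Matrix.mulVec_mulVec, h, ← Matrix.mulVec_mulVec,
      mulVec_eigProj_mulVec, Matrix.mulVec_smul]
  have h2 := congrArg (fun M => Mᴴ) h1
  simp only [Matrix.conjTranspose_mul, conjTranspose_eigProj, hA, ← Matrix.mul_assoc] at h2
  rw [← h1, h2]

lemma exists_groundFacts (hk : 1 ≤ k) (G' : Finset (SysU k)) (htype : ∀ g ∈ G', IsXOrZType g)
    (hgen : Subgroup.closure (G' : Set (SysU k)) = gaugeGroup k) :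
    ∃ αx αz, GroundFacts (penalty G') (groundProj (penalty G')) αx αz := by
  obtain ⟨Vx, Vz, hH, hx, hz⟩ := exists_penalty_eq hk G' htype hgen
  have herm : (penalty G').IsHermitian := by
    rw [hH]; exact (pauliSum_isHermitian Vx Vz).neg
  set H := penalty G' with hHdef
  set P := groundProj H with hP
  set l₀ := sInf (spectrum ℝ H) with hl₀
  have hPh : Pᴴ = P := conjTranspose_eigProj _ _
  have hPP : P * P = P := eigProj_mul_self _ _
  -- The ground space of `H = -pauliSum` is the top eigenspace of `pauliSum`, with the sign of the
  -- energy reversed.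
  have htop : IsTop Vx Vz (-l₀) := by
    have h := posSemidef_sub_groundEnergy herm
    rw [IsTop]
    convert h using 1
    rw [← hl₀, hH]
    push_cast
    rw [neg_smul]
    abel
  have heig : ∀ x, H *ᵥ x = (l₀ : ℂ) • x ↔ IsEig Vx Vz (-l₀) x := by
    intro x
    rw [IsEig, hH, Matrix.neg_mulVec, Complex.ofReal_neg, neg_smul, neg_eq_iff_eq_neg]
  have hPeig : ∀ x, IsEig Vx Vz (-l₀) (P *ᵥ x) := fun x =>
    (heig _).1 (mulVec_eigProj_mulVec H l₀ x)
  obtain ⟨ψ, hψ0, hψ⟩ := exists_ground_ne_zero herm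
  have hψ' := (heig ψ).1 hψ
  have hX : ∀ i j : Fin (2 * k), ∃ α : ℝ, 0 < α ∧ P * gX i j * P = (α : ℂ) • P := by
    intro i j
    obtain ⟨α, hα, h⟩ := exists_expectation_xMat htop (splits_of_span isRL_RL hx hz) hψ' hψ0
      (hx ▸ single_pair_mem isRL_RL i j)
    refine ⟨α, hα, eq_smul_of_expectation hPh hPP ?_ fun x => ?_⟩
    · rw [gX_eq, xMat_conjTranspose]
    · rw [gX_eq]; exact h _ (hPeig x)
  have hZ : ∀ i j : Fin (2 * k), ∃ α : ℝ, 0 < α ∧ P * gZ i j * P = (α : ℂ) • P := by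
    intro i j
    obtain ⟨α, hα, h⟩ := exists_expectation_zMat htop (splits_of_span isRL_RL.symm hz hx) hψ' hψ0
      (hz ▸ single_pair_mem isRL_RL.symm i j)
    refine ⟨α, hα, eq_smul_of_expectation hPh hPP ?_ fun x => ?_⟩
    · rw [gZ_eq, zMat_conjTranspose]
    · rw [gZ_eq]; exact h _ (hPeig x)
  choose αx hαx hαx' using hX
  choose αz hαz hαz' using hZ
  -- `Z` on all qubits, and likewise `X` in `hx1`, lies in the gauge group and commutes with it, so
  -- it fixes the ground space pointwise. The first detects `X` and `Y` errors, the second `Z`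
  -- errors.
  have hz1 : zMat 1 * P = P := ext_mulVec fun x => by
    rw [← Matrix.mulVec_mulVec]
    exact (hPeig x).zMat_stab htop (hz ▸ one_mem_gaugeMod _ _) fun v hv =>
      gaugeMod_dotProduct_one isRL_RL (hx ▸ Submodule.subset_span hv)
  have hx1 : xMat 1 * P = P := ext_mulVec fun x => by
    rw [← Matrix.mulVec_mulVec]
    exact (hPeig x).xMat_stab htop (hx ▸ one_mem_gaugeMod _ _) fun w hw =>
      gaugeMod_dotProduct_one isRL_RL.symm (hz ▸ Submodule.subset_span hw)
  have hz1' : P * zMat 1 = P := by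
    have := congrArg (fun M => Mᴴ) hz1
    simpa [Matrix.conjTranspose_mul, zMat_conjTranspose, hPh] using this
  have hx1' : P * xMat 1 = P := by
    have := congrArg (fun M => Mᴴ) hx1
    simpa [Matrix.conjTranspose_mul, xMat_conjTranspose, hPh] using this
  refine ⟨αx, αz, herm, hαx, hαz, hαx', hαz', fun i => ?_, fun i => ?_, fun q s => ?_⟩
  · rw [logX_eq]
    refine eigProj_comm_of_comm _ (xMat_conjTranspose _) ?_
    rw [hH, Matrix.neg_mul, Matrix.mul_neg, pauliSum_mul_xMat]
    intro w hw
    obtain ⟨h1, -⟩ := mem_gaugeMod.1 (hz ▸ Submodule.subset_span hw : w ∈ gaugeMod k _ _)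
    simp [dotProduct_add, h1, ZModModule.add_self]
  · rw [logZ_eq]
    refine eigProj_comm_of_comm _ (zMat_conjTranspose _) ?_
    rw [hH, Matrix.neg_mul, Matrix.mul_neg]
    refine congrArg Neg.neg ?_
    simp only [pauliSum, add_mul, mul_add, Finset.sum_mul, Finset.mul_sum]
    refine congrArg₂ (· + ·) (Finset.sum_congr rfl fun v hv => ?_)
      (Finset.sum_congr rfl fun w _ => by rw [zMat_mul, zMat_mul, add_comm])
    obtain ⟨h1, -⟩ := mem_gaugeMod.1 (hx ▸ Submodule.subset_span hv : v ∈ gaugeMod k _ _)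
    rw [zMat_mul_xMat, add_dotProduct, single_dotProduct, single_dotProduct, h1,
      ZModModule.add_self, sgn_zero, one_smul]
  · cases s
    · exact mul_mul_eq_zero_of_anticommute hz1 hz1' (zMat_one_mul_pX q)
    · refine mul_mul_eq_zero_of_anticommute hz1 hz1' ?_
      change zMat 1 * (Complex.I • ((pX q : SysOp k) * (pZ q : SysOp k))) =
        -((Complex.I • ((pX q : SysOp k) * (pZ q : SysOp k))) * zMat 1)
      have hzz : zMat 1 * (pZ q : SysOp k) = (pZ q : SysOp k) * zMat 1 := by
        change zMat 1 * zMat _ = zMat _ * zMat 1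
        rw [zMat_mul, zMat_mul, add_comm]
      rw [Matrix.mul_smul, Matrix.smul_mul, ← Matrix.mul_assoc, zMat_one_mul_pX, Matrix.neg_mul,
        Matrix.mul_assoc, hzz, Matrix.mul_assoc, smul_neg]
    · exact mul_mul_eq_zero_of_anticommute hx1 hx1' (xMat_one_mul_pZ q)

end

section

/-! ### Suprema over the time interval -/

lemma bddAbove_supT {T : ℝ} {φ : ℝ → ℝ} (hφ : ContinuousOn φ (Icc 0 T)) :
    BddAbove (range fun t : Icc (0 : ℝ) T => φ t) := by
  have h := isCompact_Icc.bddAbove_image hφ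
  rwa [image_eq_range] at h

lemma le_supT {T : ℝ} {φ : ℝ → ℝ} (hφ : ContinuousOn φ (Icc 0 T)) {t : ℝ} (ht : t ∈ Icc 0 T) :
    φ t ≤ supT T φ :=
  le_ciSup (bddAbove_supT hφ) (⟨t, ht⟩ : Icc (0 : ℝ) T)

lemma supT_le {T : ℝ} (hT : 0 ≤ T) {φ : ℝ → ℝ} {C : ℝ} (h : ∀ t ∈ Icc 0 T, φ t ≤ C) :
    supT T φ ≤ C := by
  have : Nonempty (Icc (0 : ℝ) T) := ⟨⟨0, le_rfl, hT⟩⟩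
  exact ciSup_le fun t => h t t.2

lemma supT_nonneg {T : ℝ} {φ : ℝ → ℝ} (h : ∀ t ∈ Icc 0 T, 0 ≤ φ t) : 0 ≤ supT T φ :=
  Real.iSup_nonneg fun t => h t t.2

/-! ### Continuous extension from the time interval -/

section Extend

lemma IccExtend_eq {A : Type*} {T : ℝ} (hT : 0 ≤ T) (F : ℝ → A) {t : ℝ} (ht : t ∈ Icc 0 T) :
    IccExtend hT ((Icc 0 T).domRestrict F) t = F t := by
  rw [IccExtend_of_mem hT _ ht, domRestrict_apply]

variable {A : Type*} [NormedAddCommGroup A]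

lemma continuous_extend {T : ℝ} (hT : 0 ≤ T) {F : ℝ → A} (hF : ContinuousOn F (Icc 0 T)) :
    Continuous (IccExtend hT ((Icc 0 T).domRestrict F)) :=
  Continuous.Icc_extend' (continuousOn_iff_continuous_domRestrict.1 hF)

lemma uniformContinuous_extend {T : ℝ} (hT : 0 ≤ T) {F : ℝ → A} (hF : ContinuousOn F (Icc 0 T)) :
    UniformContinuous (IccExtend hT ((Icc 0 T).domRestrict F)) :=
  (CompactSpace.uniformContinuous_of_continuous (continuousOn_iff_continuous_domRestrict.1 hF)).comp
    (LipschitzWith.projIcc hT).uniformContinuous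

variable [NormedSpace ℝ A] [CompleteSpace A]

/-- Extending `F` continuously by its end values reduces this to the fundamental theorem on the line
and covers both endpoints. -/
lemma hasDerivWithinAt_integral {T : ℝ} (hT : 0 ≤ T) {F : ℝ → A} (hF : ContinuousOn F (Icc 0 T))
    {t : ℝ} (ht : t ∈ Icc 0 T) :
    HasDerivWithinAt (fun t => ∫ τ in (0 : ℝ)..t, F τ) (F t) (Icc 0 T) t := by
  have h := ((continuous_extend hT hF).integral_hasStrictDerivAt 0 t).hasDerivAt.hasDerivWithinAt
    (s := Icc 0 T)
  rw [IccExtend_eq hT F ht] at h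
  refine h.congr_of_mem (fun s hs => ?_) ht
  refine intervalIntegral.integral_congr fun τ hτ => (IccExtend_eq hT F ?_).symm
  rw [uIcc_of_le hs.1] at hτ
  exact ⟨hτ.1, hτ.2.trans hs.2⟩

end Extend

/-! ### Norm bounds in C*-rings -/

lemma norm_mul_mul_le_of_le_one {A : Type*} [NormedRing A] {a b c : A} (ha : ‖a‖ ≤ 1) (hc : ‖c‖ ≤ 1) :
    ‖a * b * c‖ ≤ ‖b‖ := by
  calc ‖a * b * c‖ ≤ ‖a‖ * ‖b‖ * ‖c‖ :=
        (norm_mul_le _ _).trans (mul_le_mul_of_nonneg_right (norm_mul_le _ _) (norm_nonneg _))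
    _ ≤ 1 * ‖b‖ * 1 := by gcongr
    _ = ‖b‖ := by ring

lemma norm_one_le_one {A : Type*} [NormedRing A] [StarRing A] [CStarRing A] : ‖(1 : A)‖ ≤ 1 := by
  have h := CStarRing.norm_star_mul_self (x := (1 : A))
  rw [star_one, one_mul] at h
  nlinarith [norm_nonneg (1 : A)]

lemma norm_le_one_of_star_mul_self {A : Type*} [NormedRing A] [StarRing A] [CStarRing A] {u : A} (h : star u * u = 1) : ‖u‖ ≤ 1 := by
  have h1 := CStarRing.norm_star_mul_self (x := u)
  rw [h] at h1
  nlinarith [norm_nonneg u, norm_one_le_one (A := A)]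

lemma norm_le_one_of_projection {A : Type*} [NormedRing A] [StarRing A] [CStarRing A] {p : A} (hs : star p = p) (h : p * p = p) : ‖p‖ ≤ 1 := by
  have h1 := CStarRing.norm_star_mul_self (x := p)
  rw [hs, h] at h1
  nlinarith [norm_nonneg p]

lemma star_neg_I_smul_mul {A : Type*} [NormedRing A] [NormedAlgebra ℂ A] [StarRing A]
    [StarModule ℂ A] {h u : A} (hh : IsSelfAdjoint h) :
    star (-(Complex.I • (h * u))) = Complex.I • (star u * h) := by
  rw [star_neg, star_smul, star_mul, hh.star_eq, Complex.star_def, Complex.conj_I, neg_smul,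
    neg_neg]

/-! ### The interaction picture -/

section Rot

variable {A : Type*} [NormedRing A] [NormedAlgebra ℂ A]

/-- `e^{i h t}` -/
def rot (h : A) (t : ℝ) : A := NormedSpace.exp ((Complex.I * t) • h)

lemma rotInt_eq (h : A) (F : ℝ → A) (P : A) (t : ℝ) :
    rotInt h F P t = ∫ τ in (0 : ℝ)..t, rot h τ * F τ * rot h (-τ) * P := by
  simp [rotInt, rot]

lemma rot_zero (h : A) : rot h 0 = 1 := by simp [rot]

lemma star_rot [StarRing A] [CStarRing A] [StarModule ℂ A] {h : A} (hh : IsSelfAdjoint h) (t : ℝ) : star (rot h t) = rot h (-t) := by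
  rw [rot, NormedSpace.star_exp, star_smul, hh.star_eq, rot]
  simp

lemma rot_neg_mul_rot [CompleteSpace A] (h : A) (t : ℝ) : rot h (-t) * rot h t = 1 := by
  let _ : NormedAlgebra ℚ A := NormedAlgebra.restrictScalars ℚ ℂ A
  rw [rot, rot, ← NormedSpace.exp_add_of_commute, ← add_smul]
  · simp
  · exact ((Commute.refl h).smul_left _).smul_right _

lemma rot_mul_rot_neg [CompleteSpace A] (h : A) (t : ℝ) : rot h t * rot h (-t) = 1 := by
  simpa using rot_neg_mul_rot h (-t)

lemma rot_commute {h a : A} (ha : Commute h a) (t : ℝ) : Commute (rot h t) a :=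
  (ha.smul_left _).exp_left

lemma hasDerivAt_rot [CompleteSpace A] (h : A) (t : ℝ) : HasDerivAt (rot h) (Complex.I • (h * rot h t)) t := by
  have h1 := hasDerivAt_exp_smul_const (𝕂 := ℝ) (Complex.I • h) t
  have e : ∀ u : ℝ, u • Complex.I • h = (Complex.I * u) • h := fun u => by
    rw [← Complex.coe_smul u, smul_smul, mul_comm]
  simp only [e] at h1
  rw [mul_smul_comm] at h1
  have h2 : h * rot h t = rot h t * h := (rot_commute (Commute.refl h) t).symm
  rw [h2]
  exact h1

lemma continuous_rot [CompleteSpace A] (h : A) : Continuous (rot h) :=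
  continuous_iff_continuousAt.2 fun t => (hasDerivAt_rot h t).continuousAt

lemma continuousOn_rot_mul [CompleteSpace A] {h P : A} {F : ℝ → A} {s : Set ℝ} (hF : ContinuousOn F s) :
    ContinuousOn (fun τ => rot h τ * F τ * rot h (-τ) * P) s := by
  have h1 : ContinuousOn (rot h) s := (continuous_rot h).continuousOn
  have h2 : ContinuousOn (fun τ => rot h (-τ)) s :=
    ((continuous_rot h).comp continuous_neg).continuousOn
  exact ((h1.mul hF).mul h2).mul continuousOn_const

lemma hasDerivWithinAt_rotInt [CompleteSpace A] {T : ℝ} (hT : 0 ≤ T) {h P : A} {F : ℝ → A}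
    (hF : ContinuousOn F (Icc 0 T)) {t : ℝ} (ht : t ∈ Icc 0 T) :
    HasDerivWithinAt (rotInt h F P) (rot h t * F t * rot h (-t) * P) (Icc 0 T) t := by
  have h1 := hasDerivWithinAt_integral hT (continuousOn_rot_mul (h := h) (P := P) hF) ht
  exact h1.congr_of_mem (fun s _ => rotInt_eq h F P s) ht

lemma continuousOn_rotInt [CompleteSpace A] {T : ℝ} (hT : 0 ≤ T) {h P : A} {F : ℝ → A} (hF : ContinuousOn F (Icc 0 T)) :
    ContinuousOn (rotInt h F P) (Icc 0 T) :=
  fun _ ht => (hasDerivWithinAt_rotInt hT hF ht).continuousWithinAt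

lemma rotInt_zero (h : A) (F : ℝ → A) (P : A) : rotInt h F P 0 = 0 := by simp [rotInt]

/-- The left side is the derivative of `s q - i s K q` when `s' = i s (h + X)`, `q' = -i h q` and
`K' = X P`. The term `i s X q` cancels against the one from `K'`, because `P q = q`. -/
lemma interaction_deriv_identity {s h X K q P : A} (hq : P * q = q) :
    (Complex.I • (s * (h + X))) * q + s * (-(Complex.I • (h * q)))
      - Complex.I • (((Complex.I • (s * (h + X))) * K + s * (X * P)) * q
        + s * K * (-(Complex.I • (h * q))))
      = s * (h * K - K * h + X * K) * q := by
  have e : s * (X * P) * q = s * X * q := by rw [mul_assoc, mul_assoc X, hq, mul_assoc]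
  simp only [add_mul, e]
  simp only [smul_mul_assoc, mul_neg, mul_smul_comm, smul_add, smul_neg, smul_smul,
    Complex.I_mul_I, mul_add, add_mul, mul_sub, sub_mul, neg_smul, one_smul, ← mul_assoc]
  abel

end Rot

/-! ### Unitarity of evolutions -/

section CStar

variable {A : Type*} [NormedRing A] [NormedAlgebra ℂ A] [StarRing A] [CStarRing A]

variable [StarModule ℂ A] {T : ℝ} {H U : ℝ → A}

lemma IsEvolution.hasDerivWithinAt_star (hU : IsEvolution T H U)
    (hH : ∀ t ∈ Icc 0 T, IsSelfAdjoint (H t)) {t : ℝ} (ht : t ∈ Icc 0 T) :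
    HasDerivWithinAt (fun t => star (U t)) (Complex.I • (star (U t) * H t)) (Icc 0 T) t := by
  have h := (hU.2 t ht).star
  rwa [star_neg_I_smul_mul (hH t ht)] at h

/-- What commutes with the generator is a constant of motion. -/
lemma IsEvolution.star_mul_mul (hU : IsEvolution T H U)
    (hH : ∀ t ∈ Icc 0 T, IsSelfAdjoint (H t)) {M : A} (hM : ∀ t ∈ Icc 0 T, Commute (H t) M)
    {t : ℝ} (ht : t ∈ Icc 0 T) : star (U t) * M * U t = M := by
  have hd : ∀ s ∈ Icc 0 T, HasDerivWithinAt (fun t => star (U t) * M * U t) 0 (Icc 0 T) s := by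
    intro s hs
    have h := ((hU.hasDerivWithinAt_star hH hs).mul_const M).mul (hU.2 s hs)
    refine HasDerivWithinAt.congr_deriv h ?_
    have hc : H s * M = M * H s := hM s hs
    simp only [smul_mul_assoc, mul_neg, mul_smul_comm]
    rw [← sub_eq_add_neg, ← smul_sub]
    simp only [mul_assoc]
    rw [← mul_assoc (H s) M, hc, mul_assoc, sub_self, smul_zero]
  have h := norm_image_sub_le_of_norm_deriv_le_segment' hd (C := 0) (by simp) t ht
  rw [zero_mul, norm_le_zero_iff, sub_eq_zero] at h
  rw [h, hU.1]
  simp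

lemma IsEvolution.star_mul_self (hU : IsEvolution T H U)
    (hH : ∀ t ∈ Icc 0 T, IsSelfAdjoint (H t)) {t : ℝ} (ht : t ∈ Icc 0 T) :
    star (U t) * U t = 1 := by
  simpa using hU.star_mul_mul hH (M := 1) (fun t _ => Commute.one_right _) ht

/-- In infinite dimension `U* U = 1` does not imply this. The defect `U U* - 1` solves a homogeneous
linear equation with initial value zero, so it vanishes by Grönwall. -/
lemma IsEvolution.mul_star_self (hU : IsEvolution T H U)
    (hH : ∀ t ∈ Icc 0 T, IsSelfAdjoint (H t)) (hHc : ContinuousOn H (Icc 0 T))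
    {t : ℝ} (ht : t ∈ Icc 0 T) : U t * star (U t) = 1 := by
  obtain ⟨C, hC⟩ := isCompact_Icc.exists_bound_of_continuousOn hHc
  have hd : ∀ s ∈ Icc 0 T, HasDerivWithinAt (fun t => U t * star (U t) - 1)
      (-(Complex.I • (H s * (U s * star (U s) - 1) - (U s * star (U s) - 1) * H s)))
      (Icc 0 T) s := by
    intro s hs
    have h := ((hU.2 s hs).mul (hU.hasDerivWithinAt_star hH hs)).sub_const 1
    refine HasDerivWithinAt.congr_deriv h ?_
    simp only [neg_mul, smul_mul_assoc, mul_smul_comm, smul_sub, mul_sub, sub_mul, mul_one,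
      one_mul, mul_assoc]
    abel
  have h := norm_le_gronwallBound_of_norm_deriv_right_le (δ := 0) (K := 2 * C) (ε := 0)
    (fun s hs => (hd s hs).continuousWithinAt)
    (fun s hs => (hd s (Ico_subset_Icc_self hs)).mono_of_mem_nhdsWithin
      (Icc_mem_nhdsGE_of_mem hs))
    (by simp [hU.1]) (fun s hs => by
      have hs' := Ico_subset_Icc_self hs
      rw [norm_neg, norm_smul, Complex.norm_I, one_mul, add_zero]
      refine (norm_sub_le _ _).trans ((add_le_add (norm_mul_le _ _) (norm_mul_le _ _)).trans ?_)
      nlinarith [hC s hs', norm_nonneg (U s * star (U s) - 1)]) t ht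
  rw [gronwallBound_ε0_δ0, norm_le_zero_iff, sub_eq_zero] at h
  exact h

lemma IsEvolution.commute (hU : IsEvolution T H U)
    (hH : ∀ t ∈ Icc 0 T, IsSelfAdjoint (H t)) (hHc : ContinuousOn H (Icc 0 T)) {M : A}
    (hM : ∀ t ∈ Icc 0 T, Commute (H t) M) {t : ℝ} (ht : t ∈ Icc 0 T) :
    M * U t = U t * M := by
  conv_rhs => rw [← hU.star_mul_mul hH hM ht]
  rw [← mul_assoc, ← mul_assoc, hU.mul_star_self hH hHc ht, one_mul]

/-! ### Comparison of evolutions -/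

variable [CompleteSpace A]

/-- Comparison of the evolution generated by `h + H₀(t) + V(t)` with one that preserves the range
of `P` and is generated by `h + H₀(t)` there. -/
theorem norm_evolution_sub_le (hT : 0 ≤ T) {h P : A} {H₀ V Hd Ud : ℝ → A}
    (hh : IsSelfAdjoint h) (hH₀ : ∀ t ∈ Icc 0 T, IsSelfAdjoint (H₀ t))
    (hV : ∀ t ∈ Icc 0 T, IsSelfAdjoint (V t)) (hHd : ∀ t ∈ Icc 0 T, IsSelfAdjoint (Hd t))
    (hP : IsSelfAdjoint P) (hPP : P * P = P)
    (hH₀c : ContinuousOn H₀ (Icc 0 T)) (hVc : ContinuousOn V (Icc 0 T))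
    (hHdc : ContinuousOn Hd (Icc 0 T))
    (hhH : ∀ t ∈ Icc 0 T, Commute h (H₀ t)) (hhP : Commute h P)
    (hdP : ∀ t ∈ Icc 0 T, Commute (Hd t) P)
    (hdP' : ∀ t ∈ Icc 0 T, Hd t * P = (h + H₀ t) * P)
    (hH : ∀ t, H t = h + H₀ t + V t)
    (hU : IsEvolution T H U) (hUd : IsEvolution T Hd Ud) {C : ℝ}
    (hC : ∀ t ∈ Icc 0 T, ‖V t‖ * ‖rotInt h V P t‖
      + ‖rotInt h V P t * H₀ t - H₀ t * rotInt h V P t‖ ≤ C) :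
    ‖U T * P - Ud T * P‖ ≤ ‖rotInt h V P T‖ + T * C := by
  have hHs : ∀ t ∈ Icc 0 T, IsSelfAdjoint (H t) := fun t ht => by
    rw [hH]; exact (hh.add (hH₀ t ht)).add (hV t ht)
  have hHc : ContinuousOn H (Icc 0 T) := by
    rw [funext hH]; exact (continuousOn_const.add hH₀c).add hVc
  set K := rotInt h V P with hK
  -- Both evolutions in the rotating frame of `h`. There `H₀` is unchanged, as it commutes with `h`;
  -- `a` is driven by `H₀ + X` and `b` by `H₀` alone.
  set a : ℝ → A := fun t => rot h t * U t with ha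
  set b : ℝ → A := fun t => rot h t * (Ud t * P) with hb
  set X : ℝ → A := fun t => rot h t * V t * rot h (-t) with hX
  have hrs : ∀ t, star (rot h t) = rot h (-t) := star_rot hh
  have hXs : ∀ t ∈ Icc 0 T, IsSelfAdjoint (X t) := fun t ht => by
    rw [IsSelfAdjoint, hX]
    simp only [star_mul, hrs, (hV t ht).star_eq, neg_neg, mul_assoc]
  have hUdP : ∀ t ∈ Icc 0 T, P * Ud t = Ud t * P := fun t ht => hUd.commute hHd hHdc hdP ht
  have hPb : ∀ t ∈ Icc 0 T, P * b t = b t := fun t ht => by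
    have h1 : P * rot h t = rot h t * P := (rot_commute hhP t).symm
    rw [hb]
    simp only
    rw [← mul_assoc, h1, mul_assoc, ← mul_assoc P, hUdP t ht, mul_assoc, hPP]
  have hda : ∀ t ∈ Icc 0 T, HasDerivWithinAt a (-(Complex.I • ((H₀ t + X t) * a t)))
      (Icc 0 T) t := by
    intro t ht
    have h1 := (hasDerivAt_rot h t).hasDerivWithinAt.mul (hU.2 t ht)
    refine HasDerivWithinAt.congr_deriv h1 ?_
    have e1 : rot h t * H₀ t = H₀ t * rot h t := rot_commute (hhH t ht) t
    have e2 : rot h t * h = h * rot h t := rot_commute (Commute.refl h) t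
    have e3 : X t * a t = rot h t * V t * U t := by
      rw [ha, hX]
      simp only [mul_assoc]
      rw [← mul_assoc (rot h (-t)), rot_neg_mul_rot, one_mul]
    rw [add_mul, e3, hH, ha]
    simp only [mul_neg, smul_mul_assoc, mul_smul_comm, add_mul, mul_add, ← mul_assoc, e1, e2,
      smul_add]
    abel
  have hdb : ∀ t ∈ Icc 0 T, HasDerivWithinAt b (-(Complex.I • (H₀ t * b t))) (Icc 0 T) t := by
    intro t ht
    have h1 := (hasDerivAt_rot h t).hasDerivWithinAt.mul ((hUd.2 t ht).mul_const P)
    refine HasDerivWithinAt.congr_deriv h1 ?_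
    have e0 : Hd t * (Ud t * P) = (h + H₀ t) * (Ud t * P) := by
      rw [← hUdP t ht, ← mul_assoc, hdP' t ht, mul_assoc]
    have e1 : rot h t * H₀ t = H₀ t * rot h t := rot_commute (hhH t ht) t
    have e2 : rot h t * h = h * rot h t := rot_commute (Commute.refl h) t
    rw [neg_mul, smul_mul_assoc, smul_mul_assoc, mul_assoc (Hd t), e0, hb]
    simp only [mul_neg, mul_smul_comm, add_mul, mul_add, ← mul_assoc, e1, e2,
      smul_add]
    abel
  have hsa : ∀ t ∈ Icc 0 T, star (a t) * a t = 1 := fun t ht => by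
    rw [ha]
    simp only [star_mul, hrs, mul_assoc]
    rw [← mul_assoc (rot h (-t)), rot_neg_mul_rot, one_mul, hU.star_mul_self hHs ht]
  have hsa' : ∀ t ∈ Icc 0 T, a t * star (a t) = 1 := fun t ht => by
    rw [ha]
    simp only [star_mul, hrs, mul_assoc]
    rw [← mul_assoc (U t), hU.mul_star_self hHs hHc ht, one_mul, rot_mul_rot_neg]
  have hna : ∀ t ∈ Icc 0 T, ‖a t‖ ≤ 1 := fun t ht => norm_le_one_of_star_mul_self (hsa t ht)
  have hnr : ∀ t, ‖rot h t‖ ≤ 1 := fun t =>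
    norm_le_one_of_star_mul_self (by rw [hrs, rot_neg_mul_rot])
  have hnP : ‖P‖ ≤ 1 := norm_le_one_of_projection hP.star_eq hPP
  have hnb : ∀ t ∈ Icc 0 T, ‖b t‖ ≤ 1 := fun t ht => by
    have h1 : ‖Ud t‖ ≤ 1 := norm_le_one_of_star_mul_self (hUd.star_mul_self hHd ht)
    calc ‖b t‖ = ‖rot h t * Ud t * P‖ := by rw [hb, mul_assoc]
      _ ≤ ‖Ud t‖ := norm_mul_mul_le_of_le_one (hnr t) hnP
      _ ≤ 1 := h1
  -- The overlap of the two evolutions with its first-order correction: the derivative of `G`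
  -- contains `V` only through a product with `K`.
  set G : ℝ → A := fun t => star (a t) * b t - Complex.I • (star (a t) * K t * b t) with hG
  have hdG : ∀ t ∈ Icc 0 T, HasDerivWithinAt G
      (star (a t) * (H₀ t * K t - K t * H₀ t + X t * K t) * b t) (Icc 0 T) t := by
    intro t ht
    have h1 := (hda t ht).star
    rw [star_neg_I_smul_mul ((hH₀ t ht).add (hXs t ht))] at h1
    have h2 : HasDerivWithinAt K (X t * P) (Icc 0 T) t := hasDerivWithinAt_rotInt hT hVc ht
    have h3 := (h1.mul (hdb t ht)).sub (((h1.mul h2).mul (hdb t ht)).const_smul Complex.I)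
    rw [← interaction_deriv_identity (hPb t ht)]
    exact h3
  have hbound : ∀ t ∈ Ico 0 T,
      ‖star (a t) * (H₀ t * K t - K t * H₀ t + X t * K t) * b t‖ ≤ C := by
    intro t ht
    have ht' := Ico_subset_Icc_self ht
    refine (norm_mul_mul_le_of_le_one ?_ (hnb t ht')).trans ?_
    · rw [norm_star]; exact hna t ht'
    refine (norm_add_le _ _).trans (le_trans ?_ (hC t ht'))
    rw [add_comm, norm_sub_rev]
    refine add_le_add_left ((norm_mul_le _ _).trans ?_) _
    exact mul_le_mul_of_nonneg_right (norm_mul_mul_le_of_le_one (hnr t) (hnr (-t)))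
      (norm_nonneg _)
  have hTm : T ∈ Icc 0 T := ⟨hT, le_rfl⟩
  have hfin := norm_image_sub_le_of_norm_deriv_le_segment' hdG hbound T hTm
  have hG0 : G 0 = P := by
    simp [hG, ha, hb, hK, rotInt_zero, rot_zero, hU.1, hUd.1]
  rw [hG0, sub_zero] at hfin
  have hmain : ‖star (a T) * b T - P‖ ≤ ‖K T‖ + T * C := by
    have e : star (a T) * b T - P = (G T - P) + Complex.I • (star (a T) * K T * b T) := by
      rw [hG]; simp only; abel
    rw [e, add_comm ‖K T‖, mul_comm T]
    refine (norm_add_le _ _).trans (add_le_add hfin ?_)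
    rw [norm_smul, Complex.norm_I, one_mul]
    exact norm_mul_mul_le_of_le_one (by rw [norm_star]; exact hna T hTm) (hnb T hTm)
  -- Undoes the rotating frame. Here `a a* = 1` is needed, not just that `a` is an isometry.
  have e : U T * P - Ud T * P = -(rot h (-T) * a T * (star (a T) * b T - P)) := by
    have e1 : rot h (-T) * a T = U T := by
      rw [ha]; simp only; rw [← mul_assoc, rot_neg_mul_rot, one_mul]
    have e2 : rot h (-T) * b T = Ud T * P := by
      rw [hb]; simp only; rw [← mul_assoc, rot_neg_mul_rot, one_mul]
    have e3 : rot h (-T) * a T * (star (a T) * b T) = Ud T * P := by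
      rw [mul_assoc, ← mul_assoc (a T), hsa' T hTm, one_mul, e2]
    rw [mul_sub, e3, e1, neg_sub]
  rw [e, norm_neg]
  refine le_trans ?_ hmain
  calc _ ≤ ‖rot h (-T)‖ * ‖a T‖ * ‖star (a T) * b T - P‖ :=
        (norm_mul_le _ _).trans (mul_le_mul_of_nonneg_right (norm_mul_le _ _) (norm_nonneg _))
    _ ≤ 1 * 1 * ‖star (a T) * b T - P‖ := by
        gcongr
        · exact hnr _
        · exact hna T hTm
    _ = _ := by ring

end CStar

end

section

/-! ### Oscillating integrals -/

section Oscillation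

variable {X : Type*} [NormedAddCommGroup X] [NormedSpace ℂ X]

/-- The phase `e^{i ω τ}`. -/
def phase (ω τ : ℝ) : ℂ := Complex.exp (Complex.I * ω * τ)

lemma norm_phase (ω τ : ℝ) : ‖phase ω τ‖ = 1 := by
  have : Complex.I * ω * τ = ((ω * τ : ℝ) : ℂ) * Complex.I := by push_cast; ring
  rw [phase, this, Complex.norm_exp_ofReal_mul_I]

lemma hasDerivAt_phase (ω τ : ℝ) : HasDerivAt (phase ω) (Complex.I * ω * phase ω τ) τ := by
  have h1 : HasDerivAt (fun τ : ℝ => Complex.I * ω * (τ : ℂ)) (Complex.I * ω) τ := by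
    simpa using (Complex.ofRealCLM.hasDerivAt (x := τ)).const_mul (Complex.I * ω)
  exact h1.cexp.congr_deriv (mul_comm _ _)

lemma continuous_phase (ω : ℝ) : Continuous (phase ω) :=
  continuous_iff_continuousAt.2 fun τ => (hasDerivAt_phase ω τ).continuousAt

lemma phase_add_half_period {ω : ℝ} (hω : ω ≠ 0) (τ : ℝ) :
    phase ω (τ + Real.pi / ω) = -phase ω τ := by
  have hω' : (ω : ℂ) ≠ 0 := by exact_mod_cast hω
  have : Complex.I * ω * ((τ + Real.pi / ω : ℝ) : ℂ)
      = Complex.I * ω * τ + Real.pi * Complex.I := by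
    push_cast; field_simp
  rw [phase, this, Complex.exp_add, Complex.exp_pi_mul_I, phase]
  ring

variable [CompleteSpace X]

/-- Integration by parts for an oscillating integral. -/
lemma norm_integral_phase_le {T : ℝ} {F F' : ℝ → X} {ω M M' : ℝ} (hω : ω ≠ 0)
    (hF : ∀ t ∈ Icc 0 T, HasDerivWithinAt F (F' t) (Icc 0 T) t)
    (hM : ∀ t ∈ Icc 0 T, ‖F t‖ ≤ M) (hM' : ∀ t ∈ Icc 0 T, ‖F' t‖ ≤ M') {t : ℝ}
    (ht : t ∈ Icc 0 T) :
    ‖∫ τ in (0 : ℝ)..t, phase ω τ • F τ‖ ≤ (2 * M + T * M') / |ω| := by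
  have hT : 0 ≤ T := ht.1.trans ht.2
  have h0 : (0 : ℝ) ∈ Icc 0 T := ⟨le_rfl, hT⟩
  have hω' : (ω : ℂ) ≠ 0 := by exact_mod_cast hω
  set c : ℂ := (Complex.I * ω)⁻¹ with hc
  have hcn : ‖c‖ = 1 / |ω| := by simp [hc]
  have hFc : ContinuousOn F (Icc 0 T) := fun s hs => (hF s hs).continuousWithinAt
  -- Subtracting the boundary term leaves a derivative that involves only `F'`, with the factor
  -- `1/ω`. No integrability of `F'` is required, since the mean value inequality replaces
  -- integration.
  set L : ℝ → X := fun t => (∫ τ in (0 : ℝ)..t, phase ω τ • F τ) - c • (phase ω t • F t) with hL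
  have hd : ∀ s ∈ Icc 0 T, HasDerivWithinAt L (-(c • (phase ω s • F' s))) (Icc 0 T) s := by
    intro s hs
    have h1 := hasDerivWithinAt_integral hT ((continuous_phase ω).continuousOn.smul hFc) hs
    have h2 := ((hasDerivAt_phase ω s).hasDerivWithinAt.smul (hF s hs)).const_smul c
    refine (h1.sub h2).congr_deriv ?_
    have : c * (Complex.I * ω * phase ω s) = phase ω s := by
      rw [← mul_assoc, hc, inv_mul_cancel₀ (mul_ne_zero Complex.I_ne_zero hω'), one_mul]
    rw [smul_add, smul_smul c (Complex.I * ω * phase ω s), this]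
    simp
  have h := norm_image_sub_le_of_norm_deriv_le_segment' hd (C := 1 / |ω| * M') (fun s hs => by
    rw [norm_neg, norm_smul, norm_smul, norm_phase, one_mul, hcn]
    exact mul_le_mul_of_nonneg_left (hM' s (Ico_subset_Icc_self hs)) (by positivity)) t ht
  have hb : ∀ s ∈ Icc 0 T, ‖c • (phase ω s • F s)‖ ≤ 1 / |ω| * M := fun s hs => by
    rw [norm_smul, norm_smul, norm_phase, one_mul, hcn]
    exact mul_le_mul_of_nonneg_left (hM s hs) (by positivity)
  have e : (∫ τ in (0 : ℝ)..t, phase ω τ • F τ)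
      = (L t - L 0) + (c • (phase ω t • F t) - c • (phase ω 0 • F 0)) := by
    simp only [hL, intervalIntegral.integral_same]; abel
  have hM'0 : 0 ≤ M' := (norm_nonneg _).trans (hM' t ht)
  calc ‖∫ τ in (0 : ℝ)..t, phase ω τ • F τ‖
      ≤ ‖L t - L 0‖ + (‖c • (phase ω t • F t)‖ + ‖c • (phase ω 0 • F 0)‖) := by
        rw [e]; exact (norm_add_le _ _).trans (add_le_add_right (norm_sub_le _ _) _)
    _ ≤ 1 / |ω| * M' * (t - 0) + (1 / |ω| * M + 1 / |ω| * M) :=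
        add_le_add h (add_le_add (hb t ht) (hb 0 h0))
    _ ≤ 1 / |ω| * M' * T + (1 / |ω| * M + 1 / |ω| * M) := by
        rw [sub_zero]
        exact add_le_add_left (mul_le_mul_of_nonneg_left ht.2 (by positivity)) _
    _ = _ := by ring

/-- A Riemann–Lebesgue lemma which is uniform in the endpoint. -/
lemma exists_norm_integral_phase_le {X : Type*} [NormedAddCommGroup X] [NormedSpace ℂ X] {T : ℝ} (hT : 0 ≤ T) {F : ℝ → X}
    (hF : ContinuousOn F (Icc 0 T)) {ε : ℝ} (hε : 0 < ε) :
    ∃ ω₀ > 0, ∀ ω : ℝ, ω₀ ≤ |ω| → ∀ t ∈ Icc 0 T,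
      ‖∫ τ in (0 : ℝ)..t, phase ω τ • F τ‖ ≤ ε := by
  obtain ⟨M, hM⟩ := isCompact_Icc.exists_bound_of_continuousOn hF
  have hM0 : 0 ≤ M := (norm_nonneg _).trans (hM 0 ⟨le_rfl, hT⟩)
  set f : ℝ → X := IccExtend hT ((Icc 0 T).domRestrict F) with hf
  have hfc : Continuous f := continuous_extend hT hF
  have hfM : ∀ t, ‖f t‖ ≤ M := fun t => hM _ (projIcc 0 T hT t).2
  obtain ⟨δ, hδ, hδ'⟩ := Metric.uniformContinuous_iff.1 (uniformContinuous_extend hT hF)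
    (ε / (T + 1)) (by positivity)
  -- The half period must be below the modulus of uniform continuity and also short enough that the
  -- two end pieces of length `|d|` are at most `ε/2` each.
  set δ₁ := min δ (ε / (2 * M + 1)) with hδ₁
  have hδ₁0 : 0 < δ₁ := lt_min hδ (by positivity)
  refine ⟨Real.pi / δ₁ + 1, by positivity, fun ω hω t ht => ?_⟩
  have hωpos : 0 < |ω| := lt_of_lt_of_le (by positivity) hω
  have hω0 : ω ≠ 0 := abs_pos.1 hωpos
  -- A shift by the half period flips the phase, so adding the shifted integral to the original
  -- leaves only increments of `f`, up to end pieces.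
  set d := Real.pi / ω with hd
  have hd1 : |d| < δ₁ := by
    rw [hd, abs_div, abs_of_pos Real.pi_pos, div_lt_iff₀ hωpos]
    have : Real.pi / δ₁ < |ω| := by linarith
    rwa [div_lt_iff₀ hδ₁0, mul_comm] at this
  set g : ℝ → X := fun τ => phase ω τ • f τ with hg
  have hgc : Continuous g := (continuous_phase ω).smul hfc
  have hgi : ∀ a b, IntervalIntegrable g MeasureTheory.volume a b :=
    fun a b => hgc.intervalIntegrable a b
  have hgM : ∀ τ, ‖g τ‖ ≤ M := fun τ => by
    rw [hg]; simp only; rw [norm_smul, norm_phase, one_mul]; exact hfM τ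
  have hFg : (∫ τ in (0 : ℝ)..t, phase ω τ • F τ) = ∫ τ in (0 : ℝ)..t, g τ := by
    refine intervalIntegral.integral_congr fun τ hτ => ?_
    rw [uIcc_of_le ht.1] at hτ
    simp only [hg, hf, IccExtend_eq hT F ⟨hτ.1, hτ.2.trans ht.2⟩]
  rw [hFg]
  have h1 : ∫ τ in (0 : ℝ)..t, g (τ + d) = (∫ τ in (0 : ℝ)..t, g τ)
      + (∫ τ in t..t + d, g τ) - ∫ τ in (0 : ℝ)..0 + d, g τ := by
    rw [intervalIntegral.integral_comp_add_right, eq_sub_iff_add_eq, add_comm,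
      intervalIntegral.integral_add_adjacent_intervals (hgi _ _) (hgi _ _),
      intervalIntegral.integral_add_adjacent_intervals (hgi _ _) (hgi _ _)]
  have h2 : (∫ τ in (0 : ℝ)..t, g τ) + ∫ τ in (0 : ℝ)..t, g (τ + d)
      = ∫ τ in (0 : ℝ)..t, phase ω τ • (f τ - f (τ + d)) := by
    have hgd : IntervalIntegrable (fun τ => g (τ + d)) MeasureTheory.volume 0 t :=
      (hgc.comp (continuous_add_const d)).intervalIntegrable _ _
    rw [← intervalIntegral.integral_add (hgi _ _) hgd]
    refine intervalIntegral.integral_congr fun τ _ => ?_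
    simp only [hg, hd, phase_add_half_period hω0]
    rw [neg_smul, smul_sub, sub_eq_add_neg]
  have b1 : ‖∫ τ in (0 : ℝ)..t, phase ω τ • (f τ - f (τ + d))‖ ≤ ε := by
    refine (intervalIntegral.norm_integral_le_of_norm_le_const (C := ε / (T + 1))
      fun τ _ => ?_).trans ?_
    · rw [norm_smul, norm_phase, one_mul, ← dist_eq_norm]
      refine (hδ' ?_).le
      rw [Real.dist_eq, sub_add_cancel_left, abs_neg]
      exact hd1.trans_le (min_le_left _ _)
    · rw [sub_zero, abs_of_nonneg ht.1, div_mul_eq_mul_div, div_le_iff₀ (by positivity)]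
      exact mul_le_mul_of_nonneg_left (by linarith [ht.2]) hε.le
  have hMd : M * |d| ≤ ε / 2 := by
    have h3 : |d| ≤ ε / (2 * M + 1) := hd1.le.trans (min_le_right _ _)
    rw [le_div_iff₀ (by positivity)] at h3
    nlinarith [abs_nonneg d]
  have b2 : ‖∫ τ in t..t + d, g τ‖ ≤ ε / 2 := by
    refine (intervalIntegral.norm_integral_le_of_norm_le_const fun τ _ => hgM τ).trans ?_
    rwa [add_sub_cancel_left]
  have b3 : ‖∫ τ in (0 : ℝ)..0 + d, g τ‖ ≤ ε / 2 := by
    refine (intervalIntegral.norm_integral_le_of_norm_le_const fun τ _ => hgM τ).trans ?_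
    rwa [add_sub_cancel_left]
  have h4 : (2 : ℝ) • (∫ τ in (0 : ℝ)..t, g τ)
      = (∫ τ in (0 : ℝ)..t, phase ω τ • (f τ - f (τ + d))) - (∫ τ in t..t + d, g τ)
        + ∫ τ in (0 : ℝ)..0 + d, g τ := by
    rw [← h2, h1, two_smul]; abel
  have h5 : 2 * ‖∫ τ in (0 : ℝ)..t, g τ‖ ≤ ε + ε / 2 + ε / 2 := by
    have h6 := norm_smul (2 : ℝ) (∫ τ in (0 : ℝ)..t, g τ)
    rw [Real.norm_two] at h6
    rw [← h6, h4]
    exact (norm_add_le _ _).trans (add_le_add ((norm_sub_le _ _).trans (add_le_add b1 b2)) b3)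
  linarith

end Oscillation

/-! ### Spectral decomposition of the interaction picture -/

section Spectral

variable {A : Type*} [NormedRing A] [NormedAlgebra ℂ A] [CompleteSpace A]

/-- Holds term by term in the exponential series. -/
lemma exp_smul_mul_of_eigen {h p : A} {μ : ℂ} (hp : h * p = μ • p) (z : ℂ) :
    NormedSpace.exp (z • h) * p = Complex.exp (z * μ) • p := by
  have hpow : ∀ n : ℕ, (z • h) ^ n * p = (z * μ) ^ n • p := by
    intro n
    induction n with
    | zero => simp
    | succ n ih =>
      rw [pow_succ, mul_assoc, smul_mul_assoc, hp, smul_smul, mul_smul_comm, ih, smul_smul,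
        pow_succ, mul_comm]
  have h1 := (NormedSpace.exp_series_hasSum_exp' (𝕂 := ℂ) (z • h)).mul_right p
  have h2 := (NormedSpace.exp_series_hasSum_exp' (𝕂 := ℂ) (z * μ)).smul_const p
  simp only [smul_mul_assoc, hpow] at h1
  simp only [smul_eq_mul, mul_smul] at h2
  rw [Complex.exp_eq_exp_ℂ]
  exact h1.unique h2

variable {h : A} {s : Finset ℝ} {Q : ℝ → A}

lemma rot_mul_of_eigen {p : A} {μ : ℝ} (hp : h * p = (μ : ℂ) • p) (E τ : ℝ) :
    rot ((E : ℂ) • h) τ * p = phase (E * μ) τ • p := by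
  rw [rot, smul_smul, exp_smul_mul_of_eigen hp, phase]
  congr 2
  push_cast; ring

/-- If the projections `Q μ` are a spectral resolution of `h` and `F` has no block in
`Q μ₀`, then `rotInt` is a sum of oscillating integrals. -/
lemma rotInt_eq_sum (hQ : ∀ μ ∈ s, h * Q μ = (μ : ℂ) • Q μ) (hsum : ∑ μ ∈ s, Q μ = 1)
    {μ₀ : ℝ} (hμ₀ : μ₀ ∈ s) {T : ℝ} {F : ℝ → A} (hF : ContinuousOn F (Icc 0 T))
    (hF0 : ∀ t ∈ Icc 0 T, Q μ₀ * F t * Q μ₀ = 0) (E : ℝ) {t : ℝ} (ht : t ∈ Icc 0 T) :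
    rotInt ((E : ℂ) • h) F (Q μ₀) t = ∑ μ ∈ s.erase μ₀,
      ∫ τ in (0 : ℝ)..t, phase (E * (μ - μ₀)) τ • (Q μ * F τ * Q μ₀) := by
  have hsub : uIcc 0 t ⊆ Icc 0 T := by
    rw [uIcc_of_le ht.1]; exact Icc_subset_Icc_right ht.2
  rw [rotInt_eq, ← intervalIntegral.integral_finsetSum]
  · refine intervalIntegral.integral_congr fun τ hτ => ?_
    have hP : rot ((E : ℂ) • h) (-τ) * Q μ₀ = phase (E * μ₀) (-τ) • Q μ₀ :=
      rot_mul_of_eigen (hQ μ₀ hμ₀) E (-τ)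
    have hR : rot ((E : ℂ) • h) τ = ∑ μ ∈ s, phase (E * μ) τ • Q μ := by
      conv_lhs => rw [← mul_one (rot ((E : ℂ) • h) τ), ← hsum, Finset.mul_sum]
      exact Finset.sum_congr rfl fun μ hμ => rot_mul_of_eigen (hQ μ hμ) E τ
    have hph : ∀ μ, phase (E * μ₀) (-τ) * phase (E * μ) τ = phase (E * (μ - μ₀)) τ := by
      intro μ
      rw [phase, phase, phase, ← Complex.exp_add]
      congr 1
      push_cast; ring
    -- The block `μ = μ₀` is the only one that does not oscillate, and `hF0` removes it.
    rw [mul_assoc, hP, hR, Finset.sum_mul, Finset.sum_mul, ← Finset.add_sum_erase _ _ hμ₀]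
    simp only [smul_mul_assoc, mul_smul_comm, smul_smul, hph, hF0 τ (hsub hτ), smul_zero,
      zero_add]
  · intro μ _
    refine ContinuousOn.intervalIntegrable ?_
    exact (continuous_phase _).continuousOn.smul
      (((continuousOn_const.mul hF).mul continuousOn_const).mono hsub)

/-- Each block oscillates with frequency `E (μ - μ₀)`, and compression by contractions does not
increase the bounds on `F` and `F'`. -/
lemma norm_rotInt_le (hQ : ∀ μ ∈ s, h * Q μ = (μ : ℂ) • Q μ) (hsum : ∑ μ ∈ s, Q μ = 1)
    (hQn : ∀ μ, ‖Q μ‖ ≤ 1) {μ₀ : ℝ} (hμ₀ : μ₀ ∈ s) {T : ℝ} {F F' : ℝ → A}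
    (hF : ∀ t ∈ Icc 0 T, HasDerivWithinAt F (F' t) (Icc 0 T) t)
    (hF0 : ∀ t ∈ Icc 0 T, Q μ₀ * F t * Q μ₀ = 0) {M M' : ℝ}
    (hM : ∀ t ∈ Icc 0 T, ‖F t‖ ≤ M) (hM' : ∀ t ∈ Icc 0 T, ‖F' t‖ ≤ M')
    {E : ℝ} (hE : 0 < E) {t : ℝ} (ht : t ∈ Icc 0 T) :
    ‖rotInt ((E : ℂ) • h) F (Q μ₀) t‖
      ≤ 1 / E * ((2 * M + T * M') * ∑ μ ∈ s.erase μ₀, 1 / |μ₀ - μ|) := by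
  rw [rotInt_eq_sum hQ hsum hμ₀ (fun s hs => (hF s hs).continuousWithinAt) hF0 E ht,
    Finset.mul_sum, Finset.mul_sum]
  refine norm_sum_le_of_le _ fun μ hμ => ?_
  have hne : μ - μ₀ ≠ 0 := sub_ne_zero.2 (Finset.ne_of_mem_erase hμ)
  have h1 := norm_integral_phase_le (ω := E * (μ - μ₀)) (mul_ne_zero hE.ne' hne)
    (fun t ht => ((hF t ht).const_mul (Q μ)).mul_const (Q μ₀))
    (fun t ht => (norm_mul_mul_le_of_le_one (hQn μ) (hQn μ₀)).trans (hM t ht))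
    (fun t ht => (norm_mul_mul_le_of_le_one (hQn μ) (hQn μ₀)).trans (hM' t ht)) ht
  refine h1.trans (le_of_eq ?_)
  rw [abs_mul, abs_of_pos hE, abs_sub_comm μ μ₀]
  have : |μ₀ - μ| ≠ 0 := by rw [abs_sub_comm]; exact abs_ne_zero.2 hne
  field_simp

lemma exists_norm_rotInt_le (hQ : ∀ μ ∈ s, h * Q μ = (μ : ℂ) • Q μ)
    (hsum : ∑ μ ∈ s, Q μ = 1) {μ₀ : ℝ} (hμ₀ : μ₀ ∈ s) {T : ℝ} (hT : 0 ≤ T) {F : ℝ → A}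
    (hF : ContinuousOn F (Icc 0 T)) (hF0 : ∀ t ∈ Icc 0 T, Q μ₀ * F t * Q μ₀ = 0)
    {ε : ℝ} (hε : 0 < ε) :
    ∃ E₀ > 0, ∀ E : ℝ, E₀ ≤ E → ∀ t ∈ Icc 0 T, ‖rotInt ((E : ℂ) • h) F (Q μ₀) t‖ ≤ ε := by
  have h1 : ∀ μ ∈ s.erase μ₀, ∃ E₀ > 0, ∀ E : ℝ, E₀ ≤ E → ∀ t ∈ Icc 0 T,
      ‖∫ τ in (0 : ℝ)..t, phase (E * (μ - μ₀)) τ • (Q μ * F τ * Q μ₀)‖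
        ≤ ε / (s.card + 1) := by
    intro μ hμ
    obtain ⟨ω₀, hω₀, h⟩ := exists_norm_integral_phase_le hT
      (F := fun τ => Q μ * F τ * Q μ₀) ((continuousOn_const.mul hF).mul continuousOn_const)
      (ε := ε / (s.card + 1)) (by positivity)
    have hne : 0 < |μ - μ₀| := abs_pos.2 (sub_ne_zero.2 (Finset.ne_of_mem_erase hμ))
    refine ⟨ω₀ / |μ - μ₀|, by positivity, fun E hE t ht => h _ ?_ t ht⟩
    rw [abs_mul]
    rw [div_le_iff₀ hne] at hE
    exact hE.trans (mul_le_mul_of_nonneg_right (le_abs_self E) hne.le)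
  choose! e he0 he using h1
  -- The sum of the positive thresholds exceeds each of them; the `+ 1` keeps it positive when `μ₀`
  -- is the only eigenvalue.
  refine ⟨∑ μ ∈ s.erase μ₀, e μ + 1, ?_, fun E hE t ht => ?_⟩
  · have := Finset.sum_nonneg fun μ hμ => (he0 μ hμ).le
    linarith
  rw [rotInt_eq_sum hQ hsum hμ₀ hF hF0 E ht]
  refine (norm_sum_le_of_le _ fun μ hμ => he μ hμ E ?_ t ht).trans ?_
  · have := Finset.single_le_sum (fun μ hμ => (he0 μ hμ).le) hμ
    linarith
  · rw [Finset.sum_const, nsmul_eq_mul, mul_div_assoc', div_le_iff₀ (by positivity), mul_comm]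
    refine mul_le_mul_of_nonneg_left ?_ hε.le
    have : ((s.erase μ₀).card : ℝ) ≤ s.card := by
      exact_mod_cast Finset.card_le_card (Finset.erase_subset _ _)
    linarith

end Spectral

end

section

/-! ### Operators of system and bath -/

section Joint

variable {k : ℕ} {E : Type*} [NormedAddCommGroup E] [InnerProductSpace ℂ E]

lemma tens_mul (A C : SysOp k) (B D : E →L[ℂ] E) :
    tens A B * tens C D = tens (A * C) (B * D) := by
  ext ψ x
  rw [mul_apply_eq_comp, tens_apply, tens_apply]
  simp only [tens_apply, map_sum, map_smul, Matrix.mul_apply, Finset.sum_smul, Finset.smul_sum,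
    smul_smul, mul_apply_eq_comp]
  exact Finset.sum_comm

lemma tens_one_one : tens (1 : SysOp k) (1 : E →L[ℂ] E) = 1 := by
  ext ψ x
  rw [tens_apply]
  simp [Matrix.one_apply]

lemma tens_zero_left (B : E →L[ℂ] E) : tens (0 : SysOp k) B = 0 := by
  ext ψ x
  rw [tens_apply]
  simp

/-- `A ↦ A ⊗ 1` as a homomorphism of algebras. -/
def onSysHom (k : ℕ) (E : Type*) [NormedAddCommGroup E] [InnerProductSpace ℂ E] :
    SysOp k →ₐ[ℂ] JointOp k E :=
  AlgHom.ofLinearMap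
    { toFun := fun A => tens A 1
      map_add' := fun A C => by
        ext ψ x
        simp [tens_apply, add_smul, Finset.sum_add_distrib]
      map_smul' := fun c A => by
        ext ψ x
        simp [tens_apply, mul_smul, Finset.smul_sum] }
    tens_one_one (fun A C => by
      change tens (A * C) 1 = tens A 1 * tens C 1
      rw [tens_mul, one_mul])

lemma onSys_eq (A : SysOp k) : onSys E A = onSysHom k E A := rfl

lemma onSys_mul_onBath (A : SysOp k) (B : E →L[ℂ] E) : Commute (onSys E A) (onBath k B) := by
  change tens A 1 * tens 1 B = tens 1 B * tens A 1
  rw [tens_mul, tens_mul, one_mul, mul_one, one_mul, mul_one]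

lemma onSys_mul_tens_mul_onSys (A C D : SysOp k) (B : E →L[ℂ] E) :
    onSys E A * tens C B * onSys E D = tens (A * C * D) B := by
  change tens A 1 * tens C B * tens D 1 = _
  rw [tens_mul, tens_mul, one_mul, mul_one]

variable [CompleteSpace E]

lemma star_tens (A : SysOp k) (B : E →L[ℂ] E) : star (tens A B) = tens Aᴴ (star B) := by
  rw [ContinuousLinearMap.star_eq_adjoint, eq_comm, ContinuousLinearMap.eq_adjoint_iff]
  intro ψ χ
  simp only [PiLp.inner_apply, tens_apply, inner_sum, sum_inner, inner_smul_left,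
    inner_smul_right, ContinuousLinearMap.star_eq_adjoint,
    ContinuousLinearMap.adjoint_inner_left]
  rw [Finset.sum_comm]
  simp [Matrix.conjTranspose_apply]

lemma isSelfAdjoint_onSys {A : SysOp k} (hA : Aᴴ = A) : IsSelfAdjoint (onSys E A) := by
  change star (tens A 1) = tens A 1
  rw [star_tens, hA, star_one]

lemma isSelfAdjoint_onBath {B : E →L[ℂ] E} (hB : IsSelfAdjoint B) :
    IsSelfAdjoint (onBath k B) := by
  rw [IsSelfAdjoint, onBath, star_tens, Matrix.conjTranspose_one, hB.star_eq]

lemma conjTranspose_pauli (q : Qubit k) (s : Pauli) : (pauli q s)ᴴ = pauli q s := by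
  cases s
  · exact xMat_conjTranspose _
  · change (Complex.I • (xMat _ * zMat _))ᴴ = Complex.I • (xMat _ * zMat _)
    rw [Matrix.conjTranspose_smul, Matrix.conjTranspose_mul, xMat_conjTranspose,
      zMat_conjTranspose, zMat_mul_xMat, smul_smul]
    simp
  · exact zMat_conjTranspose _

lemma isSelfAdjoint_interaction {B : Qubit k → Pauli → E →L[ℂ] E}
    (hB : ∀ q s, IsSelfAdjoint (B q s)) : IsSelfAdjoint (interaction B) := by
  simp only [IsSelfAdjoint, interaction, star_sum, star_tens, conjTranspose_pauli,
    (hB _ _).star_eq]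

end Joint

/-! ### Block decompositions -/

section Blocks

variable {k : ℕ} {H : SysOp k}

lemma diagPart_add_offDiagPart (hH : H.IsHermitian) (M : SysOp k) :
    diagPart H M + offDiagPart H M = M := by
  calc diagPart H M + offDiagPart H M
      = ∑ μ ∈ eigs H, ∑ ν ∈ eigs H, eigProj H μ * M * eigProj H ν := by
        rw [diagPart, offDiagPart, ← Finset.sum_add_distrib]
        exact Finset.sum_congr rfl fun μ hμ =>
          Finset.add_sum_erase _ (fun ν => eigProj H μ * M * eigProj H ν) hμ
    _ = M := by
        simp only [← Finset.mul_sum, sum_eigProj hH, Matrix.mul_one]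
        rw [← Finset.sum_mul, sum_eigProj hH, Matrix.one_mul]

lemma conjTranspose_diagPart {M : SysOp k} (hM : Mᴴ = M) :
    (diagPart H M)ᴴ = diagPart H M := by
  rw [diagPart, Matrix.conjTranspose_sum]
  refine Finset.sum_congr rfl fun μ _ => ?_
  rw [Matrix.conjTranspose_mul, Matrix.conjTranspose_mul, conjTranspose_eigProj, hM,
    Matrix.mul_assoc]

lemma conjTranspose_offDiagPart (hH : H.IsHermitian) {M : SysOp k} (hM : Mᴴ = M) :
    (offDiagPart H M)ᴴ = offDiagPart H M := by
  have h : offDiagPart H M = M - diagPart H M :=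
    eq_sub_of_add_eq' (diagPart_add_offDiagPart hH M)
  rw [h, Matrix.conjTranspose_sub, hM, conjTranspose_diagPart hM]

lemma diagPart_mul_groundProj (hH : H.IsHermitian) (M : SysOp k) :
    diagPart H M * groundProj H = groundProj H * M * groundProj H := by
  rw [diagPart, Finset.sum_mul, Finset.sum_eq_single_of_mem _ (groundEnergy_mem hH)]
  · rw [Matrix.mul_assoc, groundProj, eigProj_mul_self]
  · intro μ _ hμ
    rw [Matrix.mul_assoc, groundProj, eigProj_mul_eigProj hH hμ, Matrix.mul_zero]

lemma groundProj_mul_self (H : SysOp k) : groundProj H * groundProj H = groundProj H :=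
  eigProj_mul_self _ _

lemma groundProj_mul_offDiagPart_mul (hH : H.IsHermitian) (M : SysOp k) :
    groundProj H * offDiagPart H M * groundProj H = 0 := by
  have h : offDiagPart H M = M - diagPart H M :=
    eq_sub_of_add_eq' (diagPart_add_offDiagPart hH M)
  rw [h, Matrix.mul_sub, Matrix.sub_mul, Matrix.mul_assoc _ (diagPart H M),
    diagPart_mul_groundProj hH, ← Matrix.mul_assoc, ← Matrix.mul_assoc, groundProj_mul_self,
    sub_self]

lemma mul_diagPart (hH : H.IsHermitian) (M : SysOp k) : H * diagPart H M = diagPart H M * H := by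
  rw [diagPart, Finset.sum_mul, Finset.mul_sum]
  refine Finset.sum_congr rfl fun μ _ => ?_
  rw [← Matrix.mul_assoc, ← Matrix.mul_assoc, mul_eigProj, Matrix.mul_assoc _ _ H,
    eigProj_mul hH, Matrix.smul_mul, Matrix.smul_mul, Matrix.mul_smul]

/-- `diagPart` as a linear map. -/
def diagPartL (H : SysOp k) : SysOp k →ₗ[ℂ] SysOp k :=
  ∑ μ ∈ eigs H, LinearMap.mulRight ℂ (eigProj H μ) ∘ₗ LinearMap.mulLeft ℂ (eigProj H μ)

lemma diagPartL_apply (H M : SysOp k) : diagPartL H M = diagPart H M := by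
  simp [diagPartL, diagPart]

end Blocks

/-! ### The computational Hamiltonians -/

section Computational

variable {k : ℕ}

lemma pX_L_mul_pX_B (i : Fin (2 * k)) :
    ((pX (Site.L, i) * pX (Site.B, i) : SysU k) : SysOp k) = logX i := by
  rw [logX_eq, pX_mul_pX, xOp_coe, add_comm]

lemma bits_add_cancel (a b c d : Bits k) : a + c + (b + d) + (c + d) = a + b := by
  rw [add_add_add_comm a c b d, add_assoc, ZModModule.add_self, add_zero]

/-- The gauge operator removes the `L` factors of the two logical ones, which is why a two-local
coupling can stand in for a four-local one. -/
lemma pX_B_mul_pX_B (i j : Fin (2 * k)) :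
    ((pX (Site.B, i) * pX (Site.B, j) : SysU k) : SysOp k) = logX i * logX j * gX i j := by
  rw [logX_eq, logX_eq, gX_eq, pX_mul_pX, xOp_coe, xMat_mul, xMat_mul, bits_add_cancel]

lemma pZ_B_mul_pZ_B (i j : Fin (2 * k)) :
    ((pZ (Site.B, i) * pZ (Site.B, j) : SysU k) : SysOp k) = logZ i * logZ j * gZ i j := by
  rw [logZ_eq, logZ_eq, gZ_eq, pZ_mul_pZ, zOp_coe, zMat_mul, zMat_mul, bits_add_cancel]

lemma hatH_eq (f : Couplings (2 * k)) (t : ℝ) : hatH f t =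
    ∑ i, (f.a i t : ℂ) • logX i + ∑ i, (f.b i t : ℂ) • logZ i
    + ∑ i, ∑ j, (f.c i j t : ℂ) • (logX i * logX j * gX i j)
    + ∑ i, ∑ j, (f.d i j t : ℂ) • (logZ i * logZ j * gZ i j) := by
  simp only [hatH, pX_L_mul_pX_B, pX_B_mul_pX_B, pZ_B_mul_pZ_B]
  rfl

lemma conjTranspose_hatH (f : Couplings (2 * k)) (t : ℝ) : (hatH f t)ᴴ = hatH f t := by
  simp only [hatH, pX_mul_pX, pZ_mul_pZ, xOp_coe, zOp_coe, Matrix.conjTranspose_add,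
    Matrix.conjTranspose_sum, Matrix.conjTranspose_smul, xMat_conjTranspose, zMat_conjTranspose,
    Complex.star_def, Complex.conj_ofReal]

lemma conjTranspose_barH (f : Couplings (2 * k)) (t : ℝ) : (barH f t)ᴴ = barH f t := by
  simp only [barH, logX_eq, logZ_eq, xMat_mul, zMat_mul, Matrix.conjTranspose_add,
    Matrix.conjTranspose_sum, Matrix.conjTranspose_smul, xMat_conjTranspose, zMat_conjTranspose,
    Complex.star_def, Complex.conj_ofReal]

variable {Hp P : SysOp k} {αx αz : Fin (2 * k) → Fin (2 * k) → ℝ}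

lemma GroundFacts.commute_barH (h : GroundFacts Hp P αx αz) (f : Couplings (2 * k)) (t : ℝ) :
    Commute (barH f t) P := by
  have hX : ∀ i, Commute (logX i) P := h.commX
  have hZ : ∀ i, Commute (logZ i) P := h.commZ
  rw [barH]
  refine Commute.add_left (Commute.add_left (Commute.add_left ?_ ?_) ?_) ?_
  · exact Commute.sum_left _ _ _ fun i _ => (hX i).smul_left _
  · exact Commute.sum_left _ _ _ fun i _ => (hZ i).smul_left _
  · exact Commute.sum_left _ _ _ fun i _ => Commute.sum_left _ _ _ fun j _ =>
      ((hX i).mul_left (hX j)).smul_left _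
  · exact Commute.sum_left _ _ _ fun i _ => Commute.sum_left _ _ _ fun j _ =>
      ((hZ i).mul_left (hZ j)).smul_left _

/-- The logical part passes through `P`, so the projection acts on the gauge factor alone. -/
lemma mul_mul_mul_of_commute {L₁ L₂ g : SysOp k} {α : ℂ} (h1 : L₁ * P = P * L₁)
    (h2 : L₂ * P = P * L₂) (hPP : P * P = P) (hg : P * g * P = α • P) :
    P * (L₁ * L₂ * g) * P = α • (P * (L₁ * L₂) * P) := by
  have h12 : Commute (L₁ * L₂) P := Commute.mul_left h1 h2
  rw [← Matrix.mul_assoc, ← h12.eq, Matrix.mul_assoc (L₁ * L₂), Matrix.mul_assoc (L₁ * L₂), hg,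
    Matrix.mul_smul, Matrix.mul_assoc (L₁ * L₂) P P, hPP]

lemma GroundFacts.hatH_eq_barH (h : GroundFacts Hp P αx αz) (hPP : P * P = P)
    (f : Couplings (2 * k)) (t : ℝ) :
    P * hatH (f.rescale αx αz) t * P = P * barH f t * P := by
  rw [hatH_eq, barH]
  simp only [Couplings.rescale, Matrix.mul_add, Matrix.add_mul, Finset.mul_sum, Finset.sum_mul,
    Matrix.mul_smul, Matrix.smul_mul]
  have e1 : ∀ i j, ((f.c i j t / αx i j : ℝ) : ℂ) • (P * (logX i * logX j * gX i j) * P)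
      = (f.c i j t : ℂ) • (P * (logX i * logX j) * P) := fun i j => by
    rw [mul_mul_mul_of_commute (h.commX i) (h.commX j) hPP (h.gaugeX i j), smul_smul]
    congr 1
    have : (αx i j : ℂ) ≠ 0 := by exact_mod_cast (h.posX i j).ne'
    push_cast; field_simp
  have e2 : ∀ i j, ((f.d i j t / αz i j : ℝ) : ℂ) • (P * (logZ i * logZ j * gZ i j) * P)
      = (f.d i j t : ℂ) • (P * (logZ i * logZ j) * P) := fun i j => by
    rw [mul_mul_mul_of_commute (h.commZ i) (h.commZ j) hPP (h.gaugeZ i j), smul_smul]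
    congr 1
    have : (αz i j : ℂ) ≠ 0 := by exact_mod_cast (h.posZ i j).ne'
    push_cast; field_simp
  simp only [e1, e2]

/-! ### Regularity in time -/

lemma Couplings.Smooth.rescale {n m : ℕ} {f : Couplings n} {T : ℝ} (h : f.Smooth m T)
    (αx αz : Fin n → Fin n → ℝ) : (f.rescale αx αz).Smooth m T :=
  ⟨h.1, h.2.1, fun i j => (h.2.2.1 i j).div_const _, fun i j => (h.2.2.2 i j).div_const _⟩

variable {X : Type*} [NormedAddCommGroup X] [NormedSpace ℂ X]

lemma contDiffOn_ofReal_smul {m : ℕ} {s : Set ℝ} {c : ℝ → ℝ} (hc : ContDiffOn ℝ m c s) (x : X) :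
    ContDiffOn ℝ m (fun t => (c t : ℂ) • x) s :=
  (Complex.ofRealCLM.contDiff.comp_contDiffOn hc).smul contDiffOn_const

/-- The linear map `L` lets one statement serve both the diagonal and the off-diagonal part, lifted
to system and bath. -/
lemma contDiffOn_hatH {m : ℕ} {f : Couplings (2 * k)} {T : ℝ} (h : f.Smooth m T)
    (L : SysOp k →ₗ[ℂ] X) : ContDiffOn ℝ m (fun t => L (hatH f t)) (Icc 0 T) := by
  simp only [hatH_eq, map_add, map_sum, map_smul]
  refine ContDiffOn.add (ContDiffOn.add (ContDiffOn.add ?_ ?_) ?_) ?_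
  · exact ContDiffOn.sum fun i _ => contDiffOn_ofReal_smul (h.1 i) _
  · exact ContDiffOn.sum fun i _ => contDiffOn_ofReal_smul (h.2.1 i) _
  · exact ContDiffOn.sum fun i _ => ContDiffOn.sum fun j _ =>
      contDiffOn_ofReal_smul (h.2.2.1 i j) _
  · exact ContDiffOn.sum fun i _ => ContDiffOn.sum fun j _ =>
      contDiffOn_ofReal_smul (h.2.2.2 i j) _

lemma contDiffOn_barH {m : ℕ} {f : Couplings (2 * k)} {T : ℝ} (h : f.Smooth m T)
    (L : SysOp k →ₗ[ℂ] X) : ContDiffOn ℝ m (fun t => L (barH f t)) (Icc 0 T) := by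
  simp only [barH, map_add, map_sum, map_smul]
  refine ContDiffOn.add (ContDiffOn.add (ContDiffOn.add ?_ ?_) ?_) ?_
  · exact ContDiffOn.sum fun i _ => contDiffOn_ofReal_smul (h.1 i) _
  · exact ContDiffOn.sum fun i _ => contDiffOn_ofReal_smul (h.2.1 i) _
  · exact ContDiffOn.sum fun i _ => ContDiffOn.sum fun j _ =>
      contDiffOn_ofReal_smul (h.2.2.1 i j) _
  · exact ContDiffOn.sum fun i _ => ContDiffOn.sum fun j _ =>
      contDiffOn_ofReal_smul (h.2.2.2 i j) _

end Computational

section OpRegularity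

variable {k : ℕ} {E : Type*} [NormedAddCommGroup E] [InnerProductSpace ℂ E]
  {Hp : SysOp k} {m : ℕ} {f : Couplings (2 * k)} {T : ℝ}

lemma contDiffOn_opH0 (h : f.Smooth m T) (HB : E →L[ℂ] E) :
    ContDiffOn ℝ m (opH0 Hp f HB) (Icc 0 T) := by
  have h1 := contDiffOn_hatH h ((onSysHom k E).toLinearMap ∘ₗ diagPartL Hp)
  simp only [LinearMap.comp_apply, diagPartL_apply] at h1
  exact h1.add contDiffOn_const

lemma contDiffOn_opV (hH : Hp.IsHermitian) (h : f.Smooth m T)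
    (B : Qubit k → Pauli → E →L[ℂ] E) : ContDiffOn ℝ m (opV Hp f B) (Icc 0 T) := by
  let L : SysOp k →ₗ[ℂ] SysOp k := LinearMap.id - diagPartL Hp
  have e : ∀ M, L M = offDiagPart Hp M := fun M => by
    rw [LinearMap.sub_apply, LinearMap.id_apply, diagPartL_apply, sub_eq_iff_eq_add']
    exact (diagPart_add_offDiagPart hH _).symm
  have h1 := contDiffOn_hatH h ((onSysHom k E).toLinearMap ∘ₗ L)
  simp only [LinearMap.comp_apply, e] at h1
  exact h1.add contDiffOn_const

lemma contDiffOn_decH (h : f.Smooth m T) (Ep : ℝ) (HB : E →L[ℂ] E) :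
    ContDiffOn ℝ m (decH Hp Ep f HB) (Icc 0 T) :=
  ((contDiffOn_barH h (onSysHom k E).toLinearMap).add contDiffOn_const).add contDiffOn_const

end OpRegularity

end

section

/-! ### The error of the penalty protection -/

section Protection

variable {k : ℕ} {Hp : SysOp k} {αx αz : Fin (2 * k) → Fin (2 * k) → ℝ}
  {E : Type*} [NormedAddCommGroup E] [InnerProductSpace ℂ E]
  {HB : E →L[ℂ] E} {B : Qubit k → Pauli → E →L[ℂ] E} {T : ℝ} {f g : Couplings (2 * k)}

lemma onSys_mul_onSys (A C : SysOp k) : onSys E A * onSys E C = onSys E (A * C) :=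
  (map_mul (onSysHom k E) A C).symm

lemma commute_onSys {A C : SysOp k} (h : A * C = C * A) : Commute (onSys E A) (onSys E C) := by
  rw [Commute, SemiconjBy, onSys_mul_onSys, onSys_mul_onSys, h]

lemma onSys_smul (c : ℂ) (A : SysOp k) : onSys E (c • A) = c • onSys E A :=
  map_smul (onSysHom k E) c A

lemma onSys_add (A C : SysOp k) : onSys E (A + C) = onSys E A + onSys E C :=
  map_add (onSysHom k E) A C

lemma ground_mul_interaction_mul
    (hF : GroundFacts Hp (groundProj Hp) αx αz) (B : Qubit k → Pauli → E →L[ℂ] E) :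
    onSys E (groundProj Hp) * interaction B * onSys E (groundProj Hp) = 0 := by
  simp only [interaction, Finset.mul_sum, Finset.sum_mul, onSys_mul_tens_mul_onSys,
    hF.local_eq_zero, tens_zero_left, Finset.sum_const_zero]

/-- The off-diagonal part has no ground block by construction, and the interaction has none by error
detection. So `V - W` is simply `V`. -/
lemma opW_eq_zero
    (hF : GroundFacts Hp (groundProj Hp) αx αz) (f : Couplings (2 * k)) (B : Qubit k → Pauli → E →L[ℂ] E) (t : ℝ) :
    opW Hp f B t = 0 := by
  rw [opW, opV, mul_add, add_mul, ground_mul_interaction_mul hF, add_zero, onSys_mul_onSys,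
    onSys_mul_onSys, groundProj_mul_offDiagPart_mul hF.herm, onSys_eq, map_zero]

lemma opK_eq
    (hF : GroundFacts Hp (groundProj Hp) αx αz) (Ep : ℝ) (f : Couplings (2 * k)) (B : Qubit k → Pauli → E →L[ℂ] E) :
    opK Hp Ep f B = rotInt ((Ep : ℂ) • onSys E Hp) (opV Hp f B) (onSys E (groundProj Hp)) := by
  ext1 t
  simp only [opK, opW_eq_zero hF, sub_zero]

lemma onSys_mul_onSys_eigProj (μ : ℝ) :
    onSys E Hp * onSys E (eigProj Hp μ) = (μ : ℂ) • onSys E (eigProj Hp μ) := by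
  rw [onSys_mul_onSys, mul_eigProj, onSys_smul]

lemma sum_onSys_eigProj
    (hF : GroundFacts Hp (groundProj Hp) αx αz) : ∑ μ ∈ eigs Hp, onSys E (eigProj Hp μ) = 1 := by
  simp only [onSys_eq]
  rw [← map_sum, sum_eigProj hF.herm, map_one]

lemma ground_mul_opV_mul
    (hF : GroundFacts Hp (groundProj Hp) αx αz) (f : Couplings (2 * k)) (t : ℝ) :
    onSys E (groundProj Hp) * opV Hp f B t * onSys E (groundProj Hp) = 0 :=
  opW_eq_zero hF f B t

lemma commute_smul_onSys {A C : SysOp k} (h : A * C = C * A) (r : ℂ) :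
    Commute (r • onSys E A) (onSys E C) := by
  rw [← onSys_smul]
  exact commute_onSys (by rw [Matrix.smul_mul, h, Matrix.mul_smul])

lemma commute_smul_onSys_opH0 (hH : Hp.IsHermitian) (r : ℂ) (f : Couplings (2 * k))
    (HB : E →L[ℂ] E) (t : ℝ) : Commute (r • onSys E Hp) (opH0 Hp f HB t) := by
  rw [opH0]
  refine Commute.add_right ?_ ?_
  · exact commute_smul_onSys (mul_diagPart hH _) r
  · rw [← onSys_smul]; exact onSys_mul_onBath _ _

lemma groundProj_comm (hH : Hp.IsHermitian) : Hp * groundProj Hp = groundProj Hp * Hp := by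
  rw [groundProj, eigProj_mul hH, mul_eigProj]

lemma commute_decH (hF : GroundFacts Hp (groundProj Hp) αx αz) (Ep : ℝ) (f : Couplings (2 * k))
    (HB : E →L[ℂ] E) (t : ℝ) : Commute (decH Hp Ep f HB t) (onSys E (groundProj Hp)) := by
  rw [decH]
  refine Commute.add_left (Commute.add_left ?_ ?_) ?_
  · exact commute_onSys (hF.commute_barH f t).eq
  · exact (onSys_mul_onBath _ _).symm
  · exact commute_smul_onSys (groundProj_comm hF.herm) _

variable [CompleteSpace E]

lemma isSelfAdjoint_smul_onSys {A : SysOp k} (hA : Aᴴ = A) (r : ℝ) :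
    IsSelfAdjoint ((r : ℂ) • onSys E A) := by
  rw [← onSys_smul]
  refine isSelfAdjoint_onSys ?_
  rw [Matrix.conjTranspose_smul, hA, Complex.star_def, Complex.conj_ofReal]

lemma isSelfAdjoint_opH0 (hHB : IsSelfAdjoint HB) (f : Couplings (2 * k)) (t : ℝ) :
    IsSelfAdjoint (opH0 Hp f HB t) := by
  rw [opH0]
  exact (isSelfAdjoint_onSys (conjTranspose_diagPart (conjTranspose_hatH f t))).add
    (isSelfAdjoint_onBath hHB)

lemma isSelfAdjoint_opV (hH : Hp.IsHermitian) (hB : ∀ q s, IsSelfAdjoint (B q s))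
    (f : Couplings (2 * k)) (t : ℝ) : IsSelfAdjoint (opV Hp f B t) := by
  rw [opV]
  exact (isSelfAdjoint_onSys (conjTranspose_offDiagPart hH (conjTranspose_hatH f t))).add
    (isSelfAdjoint_interaction hB)

lemma isSelfAdjoint_decH (hH : Hp.IsHermitian) (hHB : IsSelfAdjoint HB) (Ep : ℝ)
    (f : Couplings (2 * k)) (t : ℝ) : IsSelfAdjoint (decH Hp Ep f HB t) := by
  rw [decH]
  refine IsSelfAdjoint.add (IsSelfAdjoint.add ?_ ?_) ?_
  · exact isSelfAdjoint_onSys (conjTranspose_barH f t)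
  · exact isSelfAdjoint_onBath hHB
  · exact isSelfAdjoint_smul_onSys hH.eq Ep

lemma continuousOn_opK
    (hF : GroundFacts Hp (groundProj Hp) αx αz) (hT : 0 ≤ T) (hf : f.Smooth 0 T) (Ep : ℝ) :
    ContinuousOn (opK Hp Ep f B) (Icc 0 T) := by
  rw [opK_eq hF]
  exact continuousOn_rotInt hT (contDiffOn_opV hF.herm hf B).continuousOn

theorem norm_physical_sub_decoupled_le
    (hF : GroundFacts Hp (groundProj Hp) αx αz) (hT : 0 ≤ T) (hHB : IsSelfAdjoint HB)
    (hB : ∀ q s, IsSelfAdjoint (B q s)) (hf : f.Smooth 0 T) (hg : g = f.rescale αx αz) (Ep : ℝ)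
    {U Ud : ℝ → JointOp k E} (hU : IsEvolution T (physH Hp Ep g HB B) U)
    (hUd : IsEvolution T (decH Hp Ep f HB) Ud) :
    ‖U T * onSys E (groundProj Hp) - Ud T * onSys E (groundProj Hp)‖ ≤
      ‖opK Hp Ep g B T‖
        + T * supT T (fun t => ‖opV Hp g B t‖ + ‖opW Hp g B t‖)
            * supT T (fun t => ‖opK Hp Ep g B t‖)
        + T * supT T (fun t => ‖opK Hp Ep g B t * opH0 Hp g HB t
            - opH0 Hp g HB t * opK Hp Ep g B t‖) := by
  have hgs : g.Smooth 0 T := hg ▸ hf.rescale αx αz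
  have hVc : ContinuousOn (opV Hp g B) (Icc 0 T) := (contDiffOn_opV hF.herm hgs B).continuousOn
  have hH0c : ContinuousOn (opH0 Hp g HB) (Icc 0 T) := (contDiffOn_opH0 hgs HB).continuousOn
  have hKc : ContinuousOn (opK Hp Ep g B) (Icc 0 T) := continuousOn_opK hF hT hgs Ep
  have hcomm := (hKc.mul hH0c).sub (hH0c.mul hKc)
  have hPP := groundProj_mul_self Hp
  -- On the ground space the decoupled generator is the block-diagonal part of the physical one,
  -- which makes the abstract comparison applicable.
  have hblock : ∀ t, barH f t * groundProj Hp = diagPart Hp (hatH g t) * groundProj Hp := by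
    intro t
    rw [diagPart_mul_groundProj hF.herm, hg, hF.hatH_eq_barH hPP, ← (hF.commute_barH f t).eq,
      Matrix.mul_assoc, hPP]
  simp only [opW_eq_zero hF, norm_zero, add_zero]
  rw [mul_assoc, add_assoc, ← mul_add, opK_eq hF]
  rw [opK_eq hF] at hKc hcomm
  refine norm_evolution_sub_le hT (h := (Ep : ℂ) • onSys E Hp) (H₀ := opH0 Hp g HB)
    (V := opV Hp g B) (Hd := decH Hp Ep f HB) ?_ ?_ ?_ ?_ ?_ ?_ hH0c hVc
    (contDiffOn_decH hf Ep HB).continuousOn ?_ ?_ ?_ ?_ ?_ hU hUd ?_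
  · exact isSelfAdjoint_smul_onSys hF.herm.eq Ep
  · exact fun t _ => isSelfAdjoint_opH0 hHB g t
  · exact fun t _ => isSelfAdjoint_opV hF.herm hB g t
  · exact fun t _ => isSelfAdjoint_decH hF.herm hHB Ep f t
  · exact isSelfAdjoint_onSys (conjTranspose_eigProj _ _)
  · rw [onSys_mul_onSys, hPP]
  · exact fun t _ => commute_smul_onSys_opH0 hF.herm _ g HB t
  · exact commute_smul_onSys (groundProj_comm hF.herm) _
  · exact fun t _ => commute_decH hF Ep f HB t
  · intro t _
    rw [decH, opH0, add_mul, add_mul, add_mul, add_mul, onSys_mul_onSys, onSys_mul_onSys, hblock]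
    abel
  · intro t
    rw [physH, opH0, opV]
    conv_lhs => rw [← diagPart_add_offDiagPart hF.herm (hatH g t), onSys_add]
    abel
  · intro t ht
    refine add_le_add (mul_le_mul ?_ ?_ (norm_nonneg _) (supT_nonneg fun _ _ => norm_nonneg _)) ?_
    · exact le_supT hVc.norm ht
    · exact le_supT hKc.norm ht
    · exact le_supT hcomm.norm ht

/-- The error bound in terms of a uniform bound on `K`. -/
lemma norm_physical_sub_decoupled_le_of_norm_opK_le
    (hF : GroundFacts Hp (groundProj Hp) αx αz) (hT : 0 ≤ T) (hHB : IsSelfAdjoint HB)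
    (hB : ∀ q s, IsSelfAdjoint (B q s)) (hf : f.Smooth 0 T) (hg : g = f.rescale αx αz) (Ep : ℝ)
    {U Ud : ℝ → JointOp k E} (hU : IsEvolution T (physH Hp Ep g HB B) U)
    (hUd : IsEvolution T (decH Hp Ep f HB) Ud) {η : ℝ}
    (hη : ∀ t ∈ Icc 0 T, ‖opK Hp Ep g B t‖ ≤ η) :
    ‖U T * onSys E (groundProj Hp) - Ud T * onSys E (groundProj Hp)‖ ≤
      (1 + T * supT T (fun t => ‖opV Hp g B t‖ + ‖opW Hp g B t‖)
        + 2 * T * supT T (fun t => ‖opH0 Hp g HB t‖)) * η := by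
  have hgs : g.Smooth 0 T := hg ▸ hf.rescale αx αz
  have hH0c : ContinuousOn (opH0 Hp g HB) (Icc 0 T) := (contDiffOn_opH0 hgs HB).continuousOn
  have hTm : T ∈ Icc 0 T := ⟨hT, le_rfl⟩
  have h1 := norm_physical_sub_decoupled_le hF hT hHB hB hf hg Ep hU hUd
  set S := supT T (fun t => ‖opV Hp g B t‖ + ‖opW Hp g B t‖) with hS
  have hS0 : 0 ≤ S := supT_nonneg fun _ _ => by positivity
  have hη0 : 0 ≤ η := (norm_nonneg _).trans (hη T hTm)
  have h2 : supT T (fun t => ‖opK Hp Ep g B t‖) ≤ η := supT_le hT hη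
  have h3 : supT T (fun t => ‖opK Hp Ep g B t * opH0 Hp g HB t
      - opH0 Hp g HB t * opK Hp Ep g B t‖) ≤ 2 * supT T (fun t => ‖opH0 Hp g HB t‖) * η := by
    refine supT_le hT fun t ht => ?_
    have h4 := le_supT hH0c.norm ht
    have h5 := hη t ht
    refine (norm_sub_le _ _).trans ((add_le_add (norm_mul_le _ _) (norm_mul_le _ _)).trans ?_)
    have h6 : ‖opK Hp Ep g B t‖ * ‖opH0 Hp g HB t‖
        ≤ η * supT T (fun t => ‖opH0 Hp g HB t‖) :=
      mul_le_mul h5 h4 (norm_nonneg _) hη0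
    linarith [mul_comm ‖opH0 Hp g HB t‖ ‖opK Hp Ep g B t‖]
  have h7 := mul_le_mul_of_nonneg_left h2 (mul_nonneg hT hS0)
  have h8 := mul_le_mul_of_nonneg_left h3 hT
  have h9 := hη T hTm
  calc _ ≤ _ := h1
    _ ≤ η + T * S * η + T * (2 * supT T (fun t => ‖opH0 Hp g HB t‖) * η) := by gcongr
    _ = _ := by ring

lemma norm_onSys_eigProj_le (μ : ℝ) : ‖onSys E (eigProj Hp μ)‖ ≤ 1 :=
  norm_le_one_of_projection (isSelfAdjoint_onSys (conjTranspose_eigProj _ _)).star_eq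
    (by rw [onSys_mul_onSys, eigProj_mul_self])

lemma gapSum_nonneg (H : SysOp k) : 0 ≤ gapSum H :=
  Finset.sum_nonneg fun _ _ => Finset.sum_nonneg fun _ _ => by positivity

/-- Only transitions out of the ground level occur in `K`; they form one row of the double sum over
all pairs. -/
lemma sum_ground_gap_le {H : SysOp k} (hH : H.IsHermitian) :
    ∑ μ ∈ (eigs H).erase (sInf (spectrum ℝ H)), 1 / |sInf (spectrum ℝ H) - μ| ≤ gapSum H :=
  Finset.single_le_sum (f := fun μ => ∑ ν ∈ (eigs H).erase μ, 1 / |μ - ν|)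
    (fun _ _ => Finset.sum_nonneg fun _ _ => by positivity) (groundEnergy_mem hH)

lemma strength_nonneg (hT : 0 ≤ T) (f : Couplings (2 * k)) (B : Qubit k → Pauli → E →L[ℂ] E) :
    0 ≤ strength Hp T f B :=
  add_nonneg (mul_nonneg zero_le_two (supT_nonneg fun _ _ => norm_nonneg _))
    (mul_nonneg hT (supT_nonneg fun _ _ => norm_nonneg _))

/-- The bound on `K` for continuously differentiable couplings. -/
theorem norm_opK_le
    (hF : GroundFacts Hp (groundProj Hp) αx αz) (hT : 0 ≤ T) (hf : f.Smooth 1 T) {Ep : ℝ} (hEp : 0 < Ep) {t : ℝ}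
    (ht : t ∈ Icc 0 T) : ‖opK Hp Ep f B t‖ ≤ 1 / Ep * (strength Hp T f B * gapSum Hp) := by
  have hs0 := strength_nonneg (Hp := Hp) hT f B
  have hg0 := gapSum_nonneg Hp
  -- On a one-point interval derivatives within it are not unique, so `T = 0` is treated apart;
  -- there `K = 0`.
  rcases hT.eq_or_lt with rfl | hTpos
  · obtain rfl : t = 0 := le_antisymm ht.2 ht.1
    rw [opK_eq hF, rotInt_zero, norm_zero]
    positivity
  have hVs : ContDiffOn ℝ 1 (opV Hp f B) (Icc 0 T) := contDiffOn_opV hF.herm hf B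
  have hud := uniqueDiffOn_Icc hTpos
  have hstr : strength Hp T f B = 2 * supT T (fun t => ‖opV Hp f B t‖)
      + T * supT T fun t => ‖derivWithin (opV Hp f B) (Icc 0 T) t‖ := by
    simp only [strength, supDeriv, opW_eq_zero hF, sub_zero]
  rw [opK_eq hF]
  refine (norm_rotInt_le (s := eigs Hp) (Q := fun μ => onSys E (eigProj Hp μ))
    (F' := fun t => derivWithin (opV Hp f B) (Icc 0 T) t)
    (fun μ _ => onSys_mul_onSys_eigProj μ) (sum_onSys_eigProj hF) norm_onSys_eigProj_le
    (groundEnergy_mem hF.herm)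
    (fun t ht => ((hVs.differentiableOn one_ne_zero) t ht).hasDerivWithinAt)
    (fun t _ => ground_mul_opV_mul hF f t)
    (fun t ht => le_supT hVs.continuousOn.norm ht)
    (fun t ht => le_supT (hVs.continuousOn_derivWithin hud le_rfl).norm ht) hEp ht).trans ?_
  rw [← hstr]
  gcongr
  exact sum_ground_gap_le hF.herm

/-- For continuous couplings, `K` vanishes uniformly in the limit of a large penalty. -/
theorem exists_norm_opK_le
    (hF : GroundFacts Hp (groundProj Hp) αx αz) (hT : 0 ≤ T) (hf : f.Smooth 0 T) {ε : ℝ} (hε : 0 < ε) :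
    ∃ E₀ > 0, ∀ Ep : ℝ, E₀ ≤ Ep → ∀ t ∈ Icc 0 T, ‖opK Hp Ep f B t‖ ≤ ε := by
  simp only [opK_eq hF]
  exact exists_norm_rotInt_le (s := eigs Hp) (Q := fun μ => onSys E (eigProj Hp μ))
    (fun μ _ => onSys_mul_onSys_eigProj μ) (sum_onSys_eigProj hF) (groundEnergy_mem hF.herm) hT
    (contDiffOn_opV hF.herm hf B).continuousOn (fun t _ => ground_mul_opV_mul hF f t) hε

end Protection

end

end PenaltyCode

end

/-! ### Assembly of the main theorem -/

theorem mainTheorem5 (k : ℕ) (hk : 1 ≤ k)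
    (G' : Finset (SysU k)) (htype : ∀ g ∈ G', IsXOrZType g)
    (hgen : Subgroup.closure (G' : Set (SysU k)) = gaugeGroup k)
    (Hp : SysOp k) (hHp : Hp = penalty G') :
    ∃ αx αz : Fin (2 * k) → Fin (2 * k) → ℝ,
      (∀ i j, 0 < αx i j ∧
        groundProj Hp * gX i j * groundProj Hp = (αx i j : ℂ) • groundProj Hp) ∧
      (∀ i j, 0 < αz i j ∧
        groundProj Hp * gZ i j * groundProj Hp = (αz i j : ℂ) • groundProj Hp) ∧
      ∀ (E : Type*) [NormedAddCommGroup E] [InnerProductSpace ℂ E] [CompleteSpace E]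
        (HB : E →L[ℂ] E) (_ : IsSelfAdjoint HB)
        (B : Qubit k → Pauli → E →L[ℂ] E) (_ : ∀ q s, IsSelfAdjoint (B q s))
        (T : ℝ) (_ : 0 ≤ T) (f : Couplings (2 * k)) (_ : f.Smooth 0 T)
        (f' : Couplings (2 * k)) (_ : f' = f.rescale αx αz)
        (P : JointOp k E) (_ : P = onSys E (groundProj Hp)),
        P * interaction B * P = 0 ∧
        (∀ t, P * onSys E (hatH f' t) * P = P * onSys E (barH f t) * P) ∧
        (∀ Ep : ℝ, 0 < Ep → ∀ U Ud : ℝ → JointOp k E,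
          IsEvolution T (physH Hp Ep f' HB B) U → IsEvolution T (decH Hp Ep f HB) Ud →
          ‖U T * P - Ud T * P‖ ≤
            ‖opK Hp Ep f' B T‖
              + T * supT T (fun t => ‖opV Hp f' B t‖ + ‖opW Hp f' B t‖)
                  * supT T (fun t => ‖opK Hp Ep f' B t‖)
              + T * supT T (fun t => ‖opK Hp Ep f' B t * opH0 Hp f' HB t
                  - opH0 Hp f' HB t * opK Hp Ep f' B t‖)) ∧
        (f.Smooth 1 T → ∀ Ep : ℝ, 0 < Ep →
          (∀ t ∈ Icc 0 T, ‖opK Hp Ep f' B t‖ ≤ 1 / Ep * (strength Hp T f' B * gapSum Hp)) ∧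
          ∀ U Ud : ℝ → JointOp k E,
            IsEvolution T (physH Hp Ep f' HB B) U → IsEvolution T (decH Hp Ep f HB) Ud →
            ‖U T * P - Ud T * P‖ ≤
              1 / Ep * ((1 + T * supT T (fun t => ‖opV Hp f' B t‖ + ‖opW Hp f' B t‖)
                  + 2 * T * supT T (fun t => ‖opH0 Hp f' HB t‖))
                * (strength Hp T f' B * gapSum Hp))) ∧
        (∀ ε : ℝ, 0 < ε → ∃ E₀ : ℝ, 0 < E₀ ∧ ∀ Ep : ℝ, E₀ ≤ Ep → ∀ U Ud : ℝ → JointOp k E,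
          IsEvolution T (physH Hp Ep f' HB B) U → IsEvolution T (decH Hp Ep f HB) Ud →
          ‖U T * P - Ud T * P‖ < ε) := by
  subst hHp
  obtain ⟨αx, αz, hF⟩ := exists_groundFacts hk G' htype hgen
  refine ⟨αx, αz, fun i j => ⟨hF.posX i j, hF.gaugeX i j⟩, fun i j => ⟨hF.posZ i j, hF.gaugeZ i j⟩,
    ?_⟩
  intro E _ _ _ HB hHB B hB T hT f hf f' hf' P hP
  subst hP
  have hfs : f'.Smooth 0 T := hf' ▸ hf.rescale αx αz
  refine ⟨ground_mul_interaction_mul hF B, fun t => ?_, fun Ep _ U Ud hU hUd =>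
    norm_physical_sub_decoupled_le hF hT hHB hB hf hf' Ep hU hUd, fun hf1 Ep hEp => ?_,
    fun ε hε => ?_⟩
  · rw [onSys_mul_onSys, onSys_mul_onSys, onSys_mul_onSys, onSys_mul_onSys, hf',
      hF.hatH_eq_barH (groundProj_mul_self _)]
  · have hK : ∀ t ∈ Icc 0 T, ‖opK (penalty G') Ep f' B t‖
        ≤ 1 / Ep * (strength (penalty G') T f' B * gapSum (penalty G')) := fun t ht =>
      norm_opK_le hF hT (hf' ▸ hf1.rescale αx αz) hEp ht
    refine ⟨hK, fun U Ud hU hUd => ?_⟩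
    refine (norm_physical_sub_decoupled_le_of_norm_opK_le hF hT hHB hB hf hf' Ep hU hUd hK).trans
      (le_of_eq ?_)
    ring
  · set c := 1 + T * supT T (fun t => ‖opV (penalty G') f' B t‖ + ‖opW (penalty G') f' B t‖)
      + 2 * T * supT T (fun t => ‖opH0 (penalty G') f' HB t‖) with hc
    have h1 : 0 ≤ supT T (fun t => ‖opV (penalty G') f' B t‖ + ‖opW (penalty G') f' B t‖) :=
      supT_nonneg fun _ _ => by positivity
    have h2 : 0 ≤ supT T (fun t => ‖opH0 (penalty G') f' HB t‖) :=
      supT_nonneg fun _ _ => norm_nonneg _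
    have hc0 : 0 < c := by positivity
    -- The prefactor `c` does not involve `E_p`, so `K` can be made at most `ε / (2c)`; the factor 2
    -- yields the strict inequality.
    obtain ⟨E₀, hE₀, h⟩ := exists_norm_opK_le (B := B) hF hT hfs (div_pos hε (mul_pos two_pos hc0))
    refine ⟨E₀, hE₀, fun Ep hEp U Ud hU hUd => ?_⟩
    refine (norm_physical_sub_decoupled_le_of_norm_opK_le hF hT hHB hB hf hf' Ep hU hUd
      (h Ep hEp)).trans_lt ?_
    have : c * (ε / (2 * c)) = ε / 2 := by field_simp
    rw [← hc, this]
    exact half_lt_self hε
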